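/- Let $\mathbb{D}=\{|z|<1\}$. Every complex-valued harmonic function $f$ on $\mathbb{D}$ is written uniquely as $f=h+\overline{g}$ with $h,g$ analytic in $\mathbb{D}$ and $g(0)=0$; write $h(z)=\sum_{k\ge 0} a_kz^k$ and $g(z)=\sum_{k\ge 1} b_kz^k$. Call $f$ sense-preserving if $|h'|^2-|g'|^2>0$ in $\mathbb{D}$, and normalized if $f(0)=0$ and $h'(0)=1$. Let $\mathcal{S}^0_H$ be the class of all normalized, sense-preserving, univalent (injective) harmonic functions on $\mathbb{D}$ with $g'(0)=0$. A family $\mathscr{F}$ of normalized sense-preserving harmonic functions on $\mathbb{D}$ is called affine and linear invariant if for every $f=h+\overline{g}\in\mathscr{F}$ the functions $$z\mapsto\frac{f\left(e^{i\theta}\frac{z+a}{1+\overline{a}z}\right)-f(ae^{i\theta})}{(1-|a|^2)h'(ae^{i\theta})e^{i\theta}}\quad(\theta\in\mathbb{R},\ a\in\mathbb{D})\qquad\text{and}\qquad z\mapsto\frac{f(z)+\epsilon\overline{f(z)}}{1+\epsilon\, g'(0)}\quad(\epsilon\in\mathbb{D})$$ also belong to $\mathscr{F}$. Its order is $\overline{\mathrm{ord}}\,\mathscr{F}=\sup_{f\in\mathscr{F}}\frac{|a_2-\overline{b_1}b_2|}{1-|b_1|^2}$.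 Let $\mathscr{U}_H(\alpha)$ be the union of all affine and linear invariant families $\mathscr{F}$ with $\overline{\mathrm{ord}}\,\mathscr{F}\le\alpha$, and let $\mathscr{U}^0_H(\alpha)$ be the set of all $f=h+\overline{g}\in\mathscr{U}_H(\alpha)$ with $g'(0)=0$. For integers $n\ge1$, $m\ge2$ and $r\in(0,1)$ put $$\varphi(n,m,r)=\frac{1}{12r}\left(\frac{1-r}{1+r}\right)^3\left[1-\left(\frac{1-r}{1+r}\right)^6\right]-\sum_{k=n+1}^\infty\frac{3k^4}{4}r^{k-1}-\sum_{k=m+1}^\infty\frac{43k^4}{100}r^{k-1}.$$ **Theorem.** For all integers $n\ge1$, $m\ge2$ the equation $\varphi(n,m,r)=0$ has exactly one root $r=r_{n,m}$ in $(0,1)$, and for every $f=h+\overline{g}\in\mathscr{U}^0_H(5/2)\cap\mathcal{S}^0_H$ the section $$s_{n,m}(f)(z)=\sum_{k=1}^n a_kz^k+\overline{\sum_{k=1}^m b_kz^k}$$ is univalent in the disk $|z|<r_{n,m}$. In particular, $s_{n,n}(f)$ is univalent in $|z|<r_{n,n}$ for $n\ge2$, and $$r_{n,n}>r^L_{n,n}:=1-\frac{8\log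 n-4\log(\log n)}{n}\quad\text{for all } n\ge20.$$ Moreover, $r_{n,m}\ge r^L_{l,l}$ whenever $l=\min\{n,m\}\ge20$. -/

import Mathlib

namespace HarmonicSections

/-- The open unit disk. -/
abbrev 𝔻 : Set ℂ := Metric.ball (0 : ℂ) 1

/-- `f = h + conj g` on the open unit disk, with `h`, `g` analytic there and `g 0 = 0`:
the canonical representation of a complex-valued harmonic function on the disk.
(On the disk `f` determines `h` and `g`.) -/
structure IsCanonicalRep (f h g : ℂ → ℂ) : Prop where
  analytic_h : AnalyticOnNhd ℂ h 𝔻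
  analytic_g : AnalyticOnNhd ℂ g 𝔻
  g_zero : g 0 = 0
  eq_add : ∀ z ∈ 𝔻, f z = h z + (starRingEnd ℂ) (g z)

/-- The functions with a canonical representation are exactly the harmonic ones. -/
theorem exists_isCanonicalRep_iff (f : ℂ → ℂ) :
    (∃ h g, IsCanonicalRep f h g) ↔ InnerProductSpace.HarmonicOnNhd f 𝔻 := by
  constructor
  · rintro ⟨h, g, H⟩ x hx
    have h1 : InnerProductSpace.HarmonicAt h x := (H.analytic_h x hx).harmonicAt
    have h2 : InnerProductSpace.HarmonicAt (Complex.conjCLE.toContinuousLinearMap ∘ g) x :=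
      (H.analytic_g x hx).harmonicAt.comp_CLM _
    refine (InnerProductSpace.harmonicAt_congr_nhds ?_).1 (h1.add h2)
    filter_upwards [Metric.isOpen_ball.mem_nhds hx] with z hz
    simp [H.eq_add z hz]
  · intro hf
    have hre : InnerProductSpace.HarmonicOnNhd (Complex.reCLM ∘ f) 𝔻 := hf.comp_CLM _
    have him : InnerProductSpace.HarmonicOnNhd (Complex.imCLM ∘ f) 𝔻 := hf.comp_CLM _
    obtain ⟨F, hF, hF'⟩ := hre.exists_analyticOnNhd_ball_re_eq
    obtain ⟨G, hG, hG'⟩ := him.exists_analyticOnNhd_ball_re_eq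
    let g : ℂ → ℂ := fun z => (F z - Complex.I * G z) / 2
    let h : ℂ → ℂ := fun z => (F z + Complex.I * G z) / 2
    refine ⟨fun z => h z + (starRingEnd ℂ) (g 0), fun z => g z - g 0, ?_, ?_, by simp, ?_⟩
    · intro x hx
      have := hF x hx
      have := hG x hx
      fun_prop
    · intro x hx
      have := hF x hx
      have := hG x hx
      fun_prop
    · intro z hz
      have e1 := hF' hz
      have e2 := hG' hz
      simp only [Function.comp, Complex.reCLM_apply, Complex.imCLM_apply] at e1 e2
      apply Complex.ext
      · simp [-map_sub, -map_mul, -map_div₀, -map_add, h, g, ← e1]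
        ring
      · simp [-map_sub, -map_mul, -map_div₀, -map_add, h, g, ← e2]
        ring

/-- The `k`-th Taylor coefficient at the origin. -/
noncomputable def taylorCoeff (h : ℂ → ℂ) (k : ℕ) : ℂ :=
  iteratedDeriv k h 0 / (k.factorial : ℂ)

/-- `f = h + conj g` is a sense-preserving harmonic mapping of the disk (its Jacobian
`|h'|² - |g'|²` is positive) normalized by `f 0 = 0` and `f_z 0 = h' 0 = 1`. -/
def IsNormalizedSensePreserving (f : ℂ → ℂ) : Prop :=
  ∃ h g, IsCanonicalRep f h g ∧ f 0 = 0 ∧ deriv h 0 = 1 ∧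
    ∀ z ∈ 𝔻, 0 < ‖deriv h z‖ ^ 2 - ‖deriv g z‖ ^ 2

/-- `f_{z̄}(0) = 0`, i.e. `g' 0 = 0` for `f = h + conj g`. -/
def DzbarZeroAtOrigin (f : ℂ → ℂ) : Prop :=
  ∃ h g, IsCanonicalRep f h g ∧ deriv g 0 = 0

/-- The class `S_H^0` of normalized univalent sense-preserving harmonic mappings of the disk
with `f_{z̄}(0) = 0`. -/
def SH0 : Set (ℂ → ℂ) :=
  {f | IsNormalizedSensePreserving f ∧ Set.InjOn f 𝔻 ∧ DzbarZeroAtOrigin f}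

/-- The Koebe transform of `f = h + conj g` with parameters `θ` and `a`. -/
noncomputable def koebeTransform (f h : ℂ → ℂ) (θ : ℝ) (a : ℂ) : ℂ → ℂ := fun z =>
  (f (Complex.exp (Complex.I * θ) * ((z + a) / (1 + (starRingEnd ℂ) a * z)))
      - f (a * Complex.exp (Complex.I * θ))) /
    ((1 - (‖a‖ : ℂ) ^ 2) * deriv h (a * Complex.exp (Complex.I * θ))
      * Complex.exp (Complex.I * θ))

/-- The affine change of `f = h + conj g` with parameter `ε`; here `g' 0` is the conjugate of
`f_{z̄}(0)`. -/
noncomputable def affineChange (f g : ℂ → ℂ) (ε : ℂ) : ℂ → ℂ := fun z =>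
  (f z + ε * (starRingEnd ℂ) (f z)) / (1 + ε * deriv g 0)

/-- Affine and linear invariant families of normalized sense-preserving harmonic mappings. -/
structure IsAffineLinearInvariant (F : Set (ℂ → ℂ)) : Prop where
  normalized : ∀ f ∈ F, IsNormalizedSensePreserving f
  linear : ∀ f ∈ F, ∀ h g, IsCanonicalRep f h g →
    ∀ (θ : ℝ), ∀ a ∈ 𝔻, koebeTransform f h θ a ∈ F
  affine : ∀ f ∈ F, ∀ h g, IsCanonicalRep f h g →
    ∀ ε ∈ 𝔻, affineChange f g ε ∈ F

/-- The order `sup |a₂ - conj b₁ * b₂| / (1 - |b₁|²)` of a family, where `a_k`, `b_k` are the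
Taylor coefficients of `h`, `g` for the members `f = h + conj g`. It is an extended real. -/
noncomputable def upperOrder (F : Set (ℂ → ℂ)) : EReal :=
  sSup {q : EReal | ∃ f ∈ F, ∃ h g, IsCanonicalRep f h g ∧
    q = ((‖taylorCoeff h 2 - (starRingEnd ℂ) (taylorCoeff g 1) * taylorCoeff g 2‖
      / (1 - ‖taylorCoeff g 1‖ ^ 2) : ℝ) : EReal)}

/-- The union of all affine and linear invariant families of order at most `α`. -/
def UH (α : ℝ) : Set (ℂ → ℂ) :=
  {f | ∃ F : Set (ℂ → ℂ), IsAffineLinearInvariant F ∧ upperOrder F ≤ (α : EReal) ∧ f ∈ F}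

/-- The members of `UH α` with `f_{z̄}(0) = 0`. -/
def UH0 (α : ℝ) : Set (ℂ → ℂ) :=
  {f | f ∈ UH α ∧ DzbarZeroAtOrigin f}

/-- The section `∑_{k=1}^n a_k z^k` of an analytic function vanishing at the origin. -/
noncomputable def analyticSection (n : ℕ) (h : ℂ → ℂ) (z : ℂ) : ℂ :=
  ∑ k ∈ Finset.Icc 1 n, taylorCoeff h k * z ^ k

/-- The section `s_{n,m}(f) = s_n(h) + conj (s_m(g))` of `f = h + conj g`. -/
noncomputable def harmonicSection (n m : ℕ) (h g : ℂ → ℂ) (z : ℂ) : ℂ :=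
  analyticSection n h z + (starRingEnd ℂ) (analyticSection m g z)

/-- `R_{n,r} = ∑_{k ≥ n+1} (3 k⁴ / 4) r^{k-1}`, with `k = n + 1 + j`. -/
noncomputable def R (n : ℕ) (r : ℝ) : ℝ :=
  ∑' j : ℕ, 3 * ((n + 1 + j : ℕ) : ℝ) ^ 4 / 4 * r ^ (n + j)

/-- `T_{m,r} = ∑_{k ≥ m+1} (43 k⁴ / 100) r^{k-1}`, with `k = m + 1 + j`. -/
noncomputable def T (m : ℕ) (r : ℝ) : ℝ :=
  ∑' j : ℕ, 43 * ((m + 1 + j : ℕ) : ℝ) ^ 4 / 100 * r ^ (m + j)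

/-- The function whose zero in `(0, 1)` is the radius. -/
noncomputable def phi (n m : ℕ) (r : ℝ) : ℝ :=
  1 / (12 * r) * ((1 - r) / (1 + r)) ^ 3 * (1 - ((1 - r) / (1 + r)) ^ 6) - R n r - T m r

/-- The explicit lower bound `1 - (8 log n - 4 log log n) / n`. -/
noncomputable def rL (n : ℕ) : ℝ :=
  1 - (8 * Real.log n - 4 * Real.log (Real.log n)) / n

end HarmonicSections

namespace HarmonicSections

/-! Univalence of the sections is a perturbation argument. For `|z|, |w| ≤ r < 1` put `x = (1 - r) /
(1 + r)`. The two-point distortion `quotientBound_mul_norm_sub_le` gives `|f z - f w| ≥ x³ (1 - x⁶)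
/ (12 r) · |z - w|`. The coefficient bounds `k |a_k| ≤ 3k⁴/4` and `k |b_k| ≤ 43k⁴/100` show that
dropping the tails changes the difference by at most `(R n r + T m r) |z - w|`. Hence the section
separates `z` and `w` whenever `phi n m r > 0`. Since `phi` decreases strictly from 1 at the origin
to negative values near 1, this holds exactly below its unique root.

All analytic input comes from the order 5/2. Applied to Koebe transforms, it bounds the logarithmic
derivative of the Jacobian; radial integration gives `jacobian_bounds`. With the Schwarz lemma for
`g'/h'` this yields `|h'| ≤ (1 + r) / (1 - r)⁴`, whence the coefficient bounds by Cauchy estimates,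
and `|h'| - |g'| ≥ (1 - r)² / (1 + r)⁴`. For injective `f` the latter integrates along the preimage
of a segment to the growth theorem `growthBound_le_norm`. An affine change removes the normalization
`g'(0) = 0`, and a Koebe transform centred at one of two points turns growth into two-point
distortion.

The explicit radius comes from `phi > 0` at `rL n`, obtained by majorizing the quartic tail by a
geometric series. -/

/-! ### Quartic tails. -/

/-- The tail `∑_{k ≥ n+1} k⁴ r^{k-1}`, with `k = n + 1 + j`. -/
noncomputable def quarticTail (n : ℕ) (r : ℝ) : ℝ :=
  ∑' j : ℕ, ((n + 1 + j : ℕ) : ℝ) ^ 4 * r ^ (n + j)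

theorem R_eq_quarticTail (n : ℕ) (r : ℝ) : R n r = 3 / 4 * quarticTail n r := by
  rw [R, quarticTail, ← tsum_mul_left]
  exact tsum_congr fun j => by ring

theorem T_eq_quarticTail (n : ℕ) (r : ℝ) : T n r = 43 / 100 * quarticTail n r := by
  rw [T, quarticTail, ← tsum_mul_left]
  exact tsum_congr fun j => by ring

theorem summable_succ_pow_four_mul_pow {r : ℝ} (h0 : 0 ≤ r) (h1 : r < 1) :
    Summable fun k : ℕ => ((k + 1 : ℕ) : ℝ) ^ 4 * r ^ k := by
  have hn : ‖r‖ < 1 := by rwa [Real.norm_of_nonneg h0]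
  refine Summable.of_nonneg_of_le (fun k => by positivity) (fun k => ?_)
    (((summable_pow_mul_geometric_of_norm_lt_one 4 hn).add
      (summable_geometric_of_lt_one h0 h1)).mul_left 8)
  -- Convexity of the fourth power gives the factor `2³ = 8`.
  have hk : (((k + 1 : ℕ) : ℝ)) ^ 4 ≤ 8 * ((k : ℝ) ^ 4 + 1) := by
    push_cast
    nlinarith [sq_nonneg ((k : ℝ) ^ 2 - 1), sq_nonneg ((k : ℝ) - 1),
      sq_nonneg ((k : ℝ) ^ 2 - k), sq_nonneg ((k : ℝ) + 1)]
  calc (((k + 1 : ℕ) : ℝ)) ^ 4 * r ^ k ≤ (8 * ((k : ℝ) ^ 4 + 1)) * r ^ k := by gcongr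
    _ = _ := by ring

theorem summable_quarticTail (n : ℕ) {r : ℝ} (h0 : 0 ≤ r) (h1 : r < 1) :
    Summable fun j : ℕ => ((n + 1 + j : ℕ) : ℝ) ^ 4 * r ^ (n + j) := by
  refine ((summable_nat_add_iff n).2 (summable_succ_pow_four_mul_pow h0 h1)).congr fun j => ?_
  rw [add_comm j n, add_right_comm]

theorem quarticTail_nonneg (n : ℕ) {r : ℝ} (h0 : 0 ≤ r) : 0 ≤ quarticTail n r :=
  tsum_nonneg fun j => by positivity

theorem first_term_le_quarticTail (n : ℕ) {r : ℝ} (h0 : 0 ≤ r) (h1 : r < 1) :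
    ((n + 1 : ℕ) : ℝ) ^ 4 * r ^ n ≤ quarticTail n r :=
  (summable_quarticTail n h0 h1).le_tsum 0 fun j _ => by positivity

theorem quarticTail_zero {n : ℕ} (hn : 1 ≤ n) : quarticTail n 0 = 0 := by
  refine (tsum_congr fun j => ?_).trans tsum_zero
  rw [zero_pow (by omega), mul_zero]

theorem quarticTail_strictMonoOn {n : ℕ} (hn : 1 ≤ n) :
    StrictMonoOn (quarticTail n) (Set.Ico 0 1) := by
  intro r hr s hs hrs
  refine Summable.tsum_lt_tsum (i := 0) (fun j => ?_) ?_ (summable_quarticTail n hr.1 hr.2)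
    (summable_quarticTail n hs.1 hs.2)
  · have := hr.1
    have := hrs.le
    gcongr
  · have := pow_lt_pow_left₀ hrs hr.1 (show n + 0 ≠ 0 by omega)
    gcongr

theorem quarticTail_continuousOn (n : ℕ) {b : ℝ} (hb : b < 1) :
    ContinuousOn (quarticTail n) (Set.Icc 0 b) := by
  rcases lt_or_ge b 0 with h | h
  · simp [Set.Icc_eq_empty_of_lt h]
  refine continuousOn_tsum (fun j => by fun_prop) (summable_quarticTail n h hb) fun j x hx => ?_
  have h0 := hx.1
  have h1 := hx.2
  rw [Real.norm_of_nonneg (by positivity)]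
  gcongr

theorem quarticTail_anti {n m : ℕ} (hnm : n ≤ m) {r : ℝ} (h0 : 0 ≤ r) (h1 : r < 1) :
    quarticTail m r ≤ quarticTail n r := by
  obtain ⟨d, rfl⟩ := Nat.exists_eq_add_of_le hnm
  have h := (summable_quarticTail n h0 h1).sum_add_tsum_nat_add d
  have h2 : ∑' j : ℕ, ((n + 1 + (j + d) : ℕ) : ℝ) ^ 4 * r ^ (n + (j + d))
      = quarticTail (n + d) r :=
    tsum_congr fun j => by
      rw [show n + 1 + (j + d) = n + d + 1 + j by ring, show n + (j + d) = n + d + j by ring]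
  rw [h2] at h
  have h3 : 0 ≤ ∑ j ∈ Finset.range d, ((n + 1 + j : ℕ) : ℝ) ^ 4 * r ^ (n + j) :=
    Finset.sum_nonneg fun j _ => by positivity
  rw [quarticTail.eq_def n]
  linarith

/-- Geometric majorant: the ratio of consecutive terms is largest at the start of the tail, where it
equals `(1 + 1/(n+1))⁴ r`. -/
theorem quarticTail_le (n : ℕ) {r : ℝ} (h0 : 0 ≤ r)
    (hq : (1 + 1 / ((n : ℝ) + 1)) ^ 4 * r < 1) :
    quarticTail n r ≤
      ((n : ℝ) + 1) ^ 4 * r ^ n * (1 - (1 + 1 / ((n : ℝ) + 1)) ^ 4 * r)⁻¹ := by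
  set q := (1 + 1 / ((n : ℝ) + 1)) ^ 4 * r with hqdef
  have hq0 : 0 ≤ q := by positivity
  have hs := (hasSum_geometric_of_lt_one hq0 hq).mul_left (((n : ℝ) + 1) ^ 4 * r ^ n)
  have hle : ∀ j : ℕ, ((n + 1 + j : ℕ) : ℝ) ^ 4 * r ^ (n + j)
      ≤ ((n : ℝ) + 1) ^ 4 * r ^ n * q ^ j := by
    intro j
    -- Bernoulli's inequality with increment `1/(n+1)`.
    have hb : ((n + 1 + j : ℕ) : ℝ) ≤ ((n : ℝ) + 1) * (1 + 1 / ((n : ℝ) + 1)) ^ j := by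
      have hpos : (0 : ℝ) < (n : ℝ) + 1 := by positivity
      have := one_add_mul_le_pow (a := 1 / ((n : ℝ) + 1))
        (by have : (0 : ℝ) ≤ 1 / ((n : ℝ) + 1) := by positivity
            linarith) j
      calc ((n + 1 + j : ℕ) : ℝ) = ((n : ℝ) + 1) * (1 + j * (1 / ((n : ℝ) + 1))) := by
            push_cast; field_simp
        _ ≤ _ := by gcongr
    calc ((n + 1 + j : ℕ) : ℝ) ^ 4 * r ^ (n + j)
        ≤ (((n : ℝ) + 1) * (1 + 1 / ((n : ℝ) + 1)) ^ j) ^ 4 * r ^ (n + j) := by gcongr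
      _ = _ := by rw [hqdef, mul_pow, mul_pow, pow_add, ← pow_mul, ← pow_mul, mul_comm j 4]; ring
  have hsum : Summable fun j : ℕ => ((n + 1 + j : ℕ) : ℝ) ^ 4 * r ^ (n + j) :=
    Summable.of_nonneg_of_le (fun j => by positivity) hle hs.summable
  exact hsum.tsum_le_of_sum_le fun s =>
    (Finset.sum_le_sum fun j _ => hle j).trans (sum_le_hasSum s (fun j _ => by positivity) hs)

/-! ### The radius equation. -/

/-- The lower bound for the difference quotients of univalent members of the family,
as a polynomial in `x = (1 - r) / (1 + r)`. -/
noncomputable def quotientBound (x : ℝ) : ℝ :=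
  x ^ 3 * (1 + x) * (1 + x + x ^ 2 + x ^ 3 + x ^ 4 + x ^ 5) / 12

/-- The pole at `r = 0` is removable, since `1 - x = r (1 + x)` divides `1 - x⁶`. -/
theorem quotientBound_eq {r : ℝ} (hr : 0 < r) :
    1 / (12 * r) * ((1 - r) / (1 + r)) ^ 3 * (1 - ((1 - r) / (1 + r)) ^ 6)
      = quotientBound ((1 - r) / (1 + r)) := by
  have h1 : 1 + r ≠ 0 := by positivity
  have hx : 1 + (1 - r) / (1 + r) = 2 / (1 + r) := by field_simp; ring
  have hy : 1 - (1 - r) / (1 + r) = r * (1 + (1 - r) / (1 + r)) := by field_simp; ring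
  set x := (1 - r) / (1 + r)
  have : 1 - x ^ 6 = (1 - x) * (1 + x + x ^ 2 + x ^ 3 + x ^ 4 + x ^ 5) := by ring
  rw [this, hy, quotientBound]
  field_simp

theorem phi_eq {n m : ℕ} {r : ℝ} (hr : 0 < r) :
    phi n m r = quotientBound ((1 - r) / (1 + r)) - 3 / 4 * quarticTail n r
      - 43 / 100 * quarticTail m r := by
  rw [phi, quotientBound_eq hr, R_eq_quarticTail, T_eq_quarticTail]

theorem quotientBound_antitoneOn :
    AntitoneOn (fun r : ℝ => quotientBound ((1 - r) / (1 + r))) (Set.Icc 0 1) := by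
  intro r hr s hs hrs
  have h0 : 0 ≤ (1 - s) / (1 + s) := div_nonneg (by linarith [hs.2]) (by linarith [hs.1])
  have hx : (1 - s) / (1 + s) ≤ (1 - r) / (1 + r) := by
    rw [div_le_div_iff₀ (by linarith [hs.1]) (by linarith [hr.1])]
    nlinarith
  have h1 := h0.trans hx
  simp only [quotientBound]
  gcongr

/-- The continuous extension of `phi n m` to `[0, 1)`. -/
noncomputable def phiExt (n m : ℕ) (r : ℝ) : ℝ :=
  quotientBound ((1 - r) / (1 + r)) - 3 / 4 * quarticTail n r - 43 / 100 * quarticTail m r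

theorem phiExt_strictAntiOn {n m : ℕ} (hn : 1 ≤ n) (hm : 1 ≤ m) :
    StrictAntiOn (phiExt n m) (Set.Ico 0 1) := by
  intro r hr s hs hrs
  have h1 := quotientBound_antitoneOn (Set.Ico_subset_Icc_self hr) (Set.Ico_subset_Icc_self hs)
    hrs.le
  have h2 := quarticTail_strictMonoOn hn hr hs hrs
  have h3 := quarticTail_strictMonoOn hm hr hs hrs
  simp only [phiExt] at *
  linarith

theorem phiExt_continuousOn (n m : ℕ) {b : ℝ} (hb : b < 1) :
    ContinuousOn (phiExt n m) (Set.Icc 0 b) := by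
  have h1 := quarticTail_continuousOn n hb
  have h2 := quarticTail_continuousOn m hb
  have h3 : ContinuousOn (fun r : ℝ => (1 - r) / (1 + r)) (Set.Icc 0 b) :=
    ContinuousOn.div (by fun_prop) (by fun_prop) fun x hx => by linarith [hx.1]
  have h4 : Continuous quotientBound := by unfold quotientBound; fun_prop
  unfold phiExt
  exact ((h4.comp_continuousOn h3).sub (continuousOn_const.mul h1)).sub (continuousOn_const.mul h2)

theorem phiExt_zero {n m : ℕ} (hn : 1 ≤ n) (hm : 1 ≤ m) : phiExt n m 0 = 1 := by
  rw [phiExt, quarticTail_zero hn, quarticTail_zero hm, quotientBound]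
  norm_num

/-- As `r → 1` the quotient bound vanishes, while the first term of the tail keeps it above `r ^ n →
1`. -/
theorem exists_phiExt_neg (n m : ℕ) : ∃ b ∈ Set.Ioo (0 : ℝ) 1, phiExt n m b < 0 := by
  have hc : ContinuousAt (fun r : ℝ => quotientBound ((1 - r) / (1 + r)) - 3 / 4 * r ^ n) 1 := by
    have h4 : Continuous quotientBound := by unfold quotientBound; fun_prop
    have h3 : ContinuousAt (fun r : ℝ => (1 - r) / (1 + r)) 1 :=
      ContinuousAt.div (by fun_prop) (by fun_prop) (by norm_num)
    exact (h4.continuousAt.comp h3).sub (by fun_prop)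
  have hneg : (fun r : ℝ => quotientBound ((1 - r) / (1 + r)) - 3 / 4 * r ^ n) 1 < 0 := by
    simp [quotientBound]
  have hev := (hc.eventually_lt continuousAt_const hneg).filter_mono
    (nhdsWithin_le_nhds (s := Set.Iio 1))
  obtain ⟨b, hb1, hb⟩ := (hev.and (Ioo_mem_nhdsLT (show (0 : ℝ) < 1 by norm_num))).exists
  refine ⟨b, hb, ?_⟩
  have h1 := first_term_le_quarticTail n hb.1.le hb.2
  have h2 := quarticTail_nonneg m hb.1.le
  have h3 : b ^ n ≤ ((n + 1 : ℕ) : ℝ) ^ 4 * b ^ n := by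
    have : (1 : ℝ) ≤ ((n + 1 : ℕ) : ℝ) ^ 4 := one_le_pow₀ (by push_cast; linarith [n.cast_nonneg (α := ℝ)])
    have hb0 : 0 ≤ b ^ n := pow_nonneg hb.1.le n
    nlinarith
  simp only [phiExt] at *
  linarith

theorem exists_root {n m : ℕ} (hn : 1 ≤ n) (hm : 1 ≤ m) :
    ∃ ρ ∈ Set.Ioo (0 : ℝ) 1, phiExt n m ρ = 0 := by
  obtain ⟨b, hb, hneg⟩ := exists_phiExt_neg n m
  have h := intermediate_value_Ioo' hb.1.le (phiExt_continuousOn n m hb.2)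
  obtain ⟨ρ, hρ, h0⟩ := h ⟨hneg, by rw [phiExt_zero hn hm]; norm_num⟩
  exact ⟨ρ, ⟨hρ.1, hρ.2.trans hb.2⟩, h0⟩

theorem phiExt_mono_index {n m l : ℕ} (hn : l ≤ n) (hm : l ≤ m) {r : ℝ} (h0 : 0 ≤ r)
    (h1 : r < 1) : phiExt l l r ≤ phiExt n m r := by
  have h2 := quarticTail_anti hn h0 h1
  have h3 := quarticTail_anti hm h0 h1
  simp only [phiExt] at *
  linarith

/-! ### The explicit lower bound for the radius. -/

/-- With `r = 1 - t/n` and `L = log n`, the quotient bound is at least `t³ / (96 n³)`. The tail is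
of order `n⁵ e^{-t} / t`, and `t = 8L - 4 log L` makes `e^{-t} = L⁴ / n⁸`, so both sides scale as
`n⁻³` and it remains to compare `t⁴` with a multiple of `L⁴`. -/
theorem phiExt_pos_of_log {n : ℕ} (hn : 20 ≤ n) (hr : 0 < rL n) : 0 < phiExt n n (rL n) := by
  have hn0 : (20 : ℝ) ≤ n := by exact_mod_cast hn
  have hnpos : (0 : ℝ) < n := by linarith
  set L := Real.log n with hL
  have hL1 : 2.75 ≤ L := by
    have h16 : Real.log 16 = 4 * Real.log 2 := by
      rw [show (16 : ℝ) = 2 ^ 4 by norm_num, Real.log_pow]; norm_num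
    have := Real.log_le_log (by norm_num) (show (16 : ℝ) ≤ n by linarith)
    linarith [Real.log_two_gt_d9]
  have hLpos : 0 < L := by linarith
  set t := 8 * L - 4 * Real.log L with ht
  have ht1 : 4 * L + 4 ≤ t := by linarith [Real.log_le_sub_one_of_pos hLpos]
  have htpos : 15 ≤ t := by linarith
  have hrL : rL n = 1 - t / n := rfl
  rw [hrL] at hr ⊢
  set r := 1 - t / n with hrdef
  have htn : 0 < t / n := by positivity
  have hr1 : r < 1 := by linarith
  have hratio : (1 + 1 / ((n : ℝ) + 1)) ^ 4 ≤ 1 + 5 / (n : ℝ) := by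
    have hv : 1 / ((n : ℝ) + 1) ≤ 1 / n := by gcongr; linarith
    have hu : 1 / (n : ℝ) ≤ 1 / 20 := by gcongr
    have hu0 : 0 < 1 / (n : ℝ) := by positivity
    have : (1 + 1 / (n : ℝ)) ^ 4 ≤ 1 + 5 * (1 / n) := by
      set u := 1 / (n : ℝ)
      have : 6 * u + 4 * u ^ 2 + u ^ 3 ≤ 1 := by
        have : u ^ 2 ≤ (1 / 20) ^ 2 := by gcongr
        have : u ^ 3 ≤ (1 / 20) ^ 3 := by gcongr
        linarith
      nlinarith
    have hle : (1 + 1 / ((n : ℝ) + 1)) ^ 4 ≤ (1 + 1 / (n : ℝ)) ^ 4 := by gcongr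
    exact (hle.trans this).trans_eq (by ring)
  -- Since `t ≥ 15`, the excess `5/n` of the ratio costs at most a third of `t/n`.
  have hq : (1 + 1 / ((n : ℝ) + 1)) ^ 4 * r ≤ 1 - 2 / 3 * (t / n) := by
    calc (1 + 1 / ((n : ℝ) + 1)) ^ 4 * r ≤ (1 + 5 / n) * r := by gcongr
      _ = 1 - t / n + 5 / n - 5 / n * (t / n) := by rw [hrdef]; ring
      _ ≤ 1 - t / n + 5 / n := by
        have : 0 < 5 / (n : ℝ) * (t / n) := by positivity
        linarith
      _ ≤ 1 - t / n + 1 / 3 * (t / n) := by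
        have : 5 / (n : ℝ) ≤ 1 / 3 * (t / n) := by
          rw [← mul_div_assoc]; gcongr; linarith
        linarith
      _ = _ := by ring
  have htail := quarticTail_le n hr.le (by linarith)
  have hpow : r ^ n ≤ L ^ 4 / (n : ℝ) ^ 8 := by
    have h1 : r ≤ Real.exp (-(t / n)) := by linarith [Real.add_one_le_exp (-(t / n))]
    calc r ^ n ≤ Real.exp (-(t / n)) ^ n := by gcongr
      _ = Real.exp (4 * Real.log L - 8 * L) := by
        rw [← Real.exp_nat_mul]; congr 1; rw [ht]; field_simp; ring
      _ = L ^ 4 / (n : ℝ) ^ 8 := by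
        rw [Real.exp_sub, show 4 * Real.log L = Real.log (L ^ 4) by rw [Real.log_pow]; norm_num,
          show 8 * L = Real.log ((n : ℝ) ^ 8) by rw [Real.log_pow]; norm_num [hL],
          Real.exp_log (by positivity), Real.exp_log (by positivity)]
  have hn4 : ((n : ℝ) + 1) ^ 4 ≤ 1.2156 * (n : ℝ) ^ 4 := by
    calc ((n : ℝ) + 1) ^ 4 ≤ (1.05 * (n : ℝ)) ^ 4 := by gcongr; linarith
      _ = 1.05 ^ 4 * (n : ℝ) ^ 4 := by ring
      _ ≤ _ := by gcongr; norm_num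
  have hinv : (1 - (1 + 1 / ((n : ℝ) + 1)) ^ 4 * r)⁻¹ ≤ (2 / 3 * (t / n))⁻¹ := by
    gcongr; linarith
  have htail' : quarticTail n r ≤ 1.2156 * (n : ℝ) ^ 4 * (L ^ 4 / (n : ℝ) ^ 8)
      * (2 / 3 * (t / n))⁻¹ := by
    refine htail.trans ?_
    have : 0 ≤ (1 - (1 + 1 / ((n : ℝ) + 1)) ^ 4 * r)⁻¹ := inv_nonneg.2 (by
      have : 0 < t / n := by positivity
      linarith)
    gcongr
  have htail2 : quarticTail n r ≤ 1.8234 * L ^ 4 / (t * (n : ℝ) ^ 3) := by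
    refine htail'.trans (le_of_eq ?_)
    field_simp
    norm_num
  have hx : t / (2 * n) ≤ (1 - r) / (1 + r) := by
    rw [show t / (2 * n) = (1 - r) / 2 by rw [hrdef]; field_simp; ring]
    have : 0 ≤ 1 - r := by linarith
    gcongr
    linarith
  have hquot : (t / (2 * n)) ^ 3 / 12 ≤ quotientBound ((1 - r) / (1 + r)) := by
    have h0 : 0 < t / (2 * n) := by positivity
    set x := (1 - r) / (1 + r)
    have hx0 : 0 ≤ x := h0.le.trans hx
    rw [quotientBound]
    have h1 : 1 ≤ (1 + x) * (1 + x + x ^ 2 + x ^ 3 + x ^ 4 + x ^ 5) := by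
      have a : 1 ≤ 1 + x := by linarith
      have b : 1 ≤ 1 + x + x ^ 2 + x ^ 3 + x ^ 4 + x ^ 5 := by
        have : 0 ≤ x + x ^ 2 + x ^ 3 + x ^ 4 + x ^ 5 := by positivity
        linarith
      exact one_le_mul_of_one_le_of_one_le a b
    have h2 : (t / (2 * n)) ^ 3 ≤ x ^ 3 := by gcongr
    have h3 : 0 ≤ x ^ 3 := by positivity
    nlinarith
  -- Here `1.18 = 3/4 + 43/100` and `1.8234 = 1.2156 · 3/2`. The claim reduces to `1.18 · 1.8234 ·
  -- 96 < 207 < 4⁴`, because `t ≥ 4L`.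
  have hfin : 1.18 * (1.8234 * L ^ 4 / (t * (n : ℝ) ^ 3)) < (t / (2 * n)) ^ 3 / 12 := by
    have h4 : (4 * L) ^ 4 ≤ t ^ 4 := by gcongr; linarith
    have h5 : 0 < L ^ 4 := by positivity
    rw [show (t / (2 * (n : ℝ))) ^ 3 / 12 = (t ^ 4 / 96) / (t * (n : ℝ) ^ 3) by field_simp; ring,
      ← mul_div_assoc]
    gcongr
    nlinarith
  rw [phiExt]
  linarith

theorem rL_lt_one {n : ℕ} (hn : 20 ≤ n) : rL n < 1 := by
  have hn0 : (20 : ℝ) ≤ n := by exact_mod_cast hn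
  have hL : 0 < Real.log n := Real.log_pos (by linarith)
  have h := Real.log_le_sub_one_of_pos hL
  have : 0 < (8 * Real.log n - 4 * Real.log (Real.log n)) / n := by
    apply div_pos <;> linarith
  rw [rL]
  linarith

/-- `phiExt` is positive at `rL l` for the index pair `(l, l)`, hence for larger indices, whose
tails are smaller; being decreasing, it vanishes only further right. -/
theorem rL_lt_of_phiExt_eq_zero {n m l : ℕ} (hl : 20 ≤ l) (hn : l ≤ n) (hm : l ≤ m) {ρ : ℝ}
    (hρ : ρ ∈ Set.Ioo (0 : ℝ) 1) (h : phiExt n m ρ = 0) : rL l < ρ := by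
  rcases le_or_gt (rL l) 0 with h0 | h0
  · exact h0.trans_lt hρ.1
  by_contra! hle
  have h1 := rL_lt_one hl
  have h2 := (phiExt_pos_of_log hl h0).trans_le (phiExt_mono_index hn hm h0.le h1)
  have h3 := (phiExt_strictAntiOn (show 1 ≤ n by omega) (show 1 ≤ m by omega)).antitoneOn
    ⟨hρ.1.le, hρ.2⟩ ⟨h0.le, h1⟩ hle
  linarith

/-! ### Numerical inequalities behind 3/4 and 43/100. -/

/-- The right side is the [2/1] Padé approximant of `log (1 + x)`. After cross-multiplying, the
derivatives differ by exactly `4x³`. -/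
theorem log_one_add_le {x : ℝ} (hx : 0 ≤ x) :
    Real.log (1 + x) ≤ x * (6 + x) / (6 + 4 * x) := by
  have hmono : MonotoneOn (fun x : ℝ => x * (6 + x) / (6 + 4 * x) - Real.log (1 + x))
      (Set.Ici 0) := by
    have hd : ∀ x : ℝ, 0 ≤ x → HasDerivAt
        (fun x : ℝ => x * (6 + x) / (6 + 4 * x) - Real.log (1 + x))
        (((1 * (6 + x) + x * 1) * (6 + 4 * x) - x * (6 + x) * (4 * 1)) / (6 + 4 * x) ^ 2
          - 1 / (1 + x)) x := by
      intro x hx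
      have h1 := (hasDerivAt_id x).const_add 6
      have h2 := ((hasDerivAt_id x).const_mul 4).const_add 6
      exact (((hasDerivAt_id x).mul h1).div h2 (by simp; positivity)).sub
        (((hasDerivAt_id x).const_add 1).log (by simp; positivity))
    refine monotoneOn_of_hasDerivWithinAt_nonneg (convex_Ici 0)
      (fun x hx => (hd x hx).continuousAt.continuousWithinAt)
      (fun x hx => (hd x (interior_subset hx)).hasDerivWithinAt) fun x hx => ?_
    have hx : 0 ≤ x := interior_subset hx
    rw [sub_nonneg, div_le_div_iff₀ (by positivity) (by positivity)]
    have : 0 ≤ x ^ 3 := by positivity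
    nlinarith
  have := hmono Set.self_mem_Ici hx hx
  simp only [zero_mul, zero_div, add_zero, Real.log_one, sub_zero] at this
  linarith

theorem one_add_four_div_pow_le {p : ℕ} (hp : 1 ≤ p) :
    (1 + 4 / (p : ℝ)) ^ p ≤ Real.exp (4 - 24 / (3 * p + 8)) := by
  have hp0 : (1 : ℝ) ≤ p := by exact_mod_cast hp
  have hp1 : (0 : ℝ) < p := by linarith
  rw [← Real.exp_log (show 0 < (1 + 4 / (p : ℝ)) ^ p by positivity), Real.log_pow,
    Real.exp_le_exp]
  calc (p : ℝ) * Real.log (1 + 4 / p)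
      ≤ p * (4 / p * (6 + 4 / p) / (6 + 4 * (4 / p))) := by
        gcongr
        exact log_one_add_le (by positivity)
    _ = 4 - 24 / (3 * p + 8) := by field_simp; ring

theorem exp_four_le : Real.exp 4 ≤ 55.04 := by
  have : Real.exp 4 = Real.exp 1 ^ 4 := by rw [← Real.exp_nat_mul]; norm_num
  rw [this]
  calc Real.exp 1 ^ 4 ≤ 2.7182818286 ^ 4 := by gcongr; exact Real.exp_one_lt_d9.le
    _ ≤ _ := by norm_num

/-- As `p → ∞` the ratio of the left side to `(p+2)³` tends to `e⁴/128 < 55.04/128 = 43/100`. The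
deficit `24/(3p+8)` in the exponent outweighs the factor `((p+4)/(p+2))³ ≤ e^{6/(p+2)}`. -/
theorem coanalytic_coeff_bound {p : ℕ} (hp : 1 ≤ p) :
    (1 + 4 / (p : ℝ)) ^ p * ((p : ℝ) + 4) ^ 3 / 128 ≤ 43 / 100 * ((p : ℝ) + 2) ^ 3 := by
  have hp0 : (1 : ℝ) ≤ p := by exact_mod_cast hp
  have h1 : ((p : ℝ) + 4) / (p + 2) ≤ Real.exp (2 / (p + 2)) := by
    have := Real.add_one_le_exp (2 / ((p : ℝ) + 2))
    calc ((p : ℝ) + 4) / (p + 2) = 2 / (p + 2) + 1 := by field_simp; ring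
      _ ≤ _ := this
  have h2 : (1 + 4 / (p : ℝ)) ^ p * (((p : ℝ) + 4) / (p + 2)) ^ 3 ≤ Real.exp 4 := by
    calc (1 + 4 / (p : ℝ)) ^ p * (((p : ℝ) + 4) / (p + 2)) ^ 3
        ≤ Real.exp (4 - 24 / (3 * p + 8)) * Real.exp (2 / (p + 2)) ^ 3 := by
          gcongr
          exact one_add_four_div_pow_le hp
      _ = Real.exp (4 - 24 / (3 * p + 8) + 6 / (p + 2)) := by
          rw [← Real.exp_nat_mul, ← Real.exp_add]; congr 1; push_cast; ring
      _ ≤ Real.exp 4 := by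
          rw [Real.exp_le_exp]
          have : 6 / ((p : ℝ) + 2) ≤ 24 / (3 * p + 8) := by
            rw [div_le_div_iff₀ (by positivity) (by positivity)]
            nlinarith
          linarith
  have h3 := h2.trans exp_four_le
  rw [div_pow, ← mul_div_assoc, div_le_iff₀ (by positivity)] at h3
  linarith

/-- Equality holds at `q = 2`, which is where 3/4 comes from. -/
theorem analytic_coeff_bound {q : ℕ} (hq : 2 ≤ q) :
    (1 + 4 / (q : ℝ)) ^ q * ((q : ℝ) + 2) * ((q : ℝ) + 4) ^ 3 / 128
      ≤ 3 / 4 * ((q : ℝ) + 1) ^ 4 := by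
  rcases lt_or_ge q 6 with h | h
  · interval_cases q <;> norm_num
  have hq1 : (1 : ℝ) ≤ q := by exact_mod_cast (show 1 ≤ q by omega)
  have h1 : (1 + 4 / (q : ℝ)) ^ q ≤ 55.04 * ((3 * q + 8) / (3 * q + 32)) := by
    have h2 : (3 * (q : ℝ) + 32) / (3 * q + 8) ≤ Real.exp (24 / (3 * q + 8)) := by
      have := Real.add_one_le_exp (24 / (3 * (q : ℝ) + 8))
      calc (3 * (q : ℝ) + 32) / (3 * q + 8) = 24 / (3 * q + 8) + 1 := by field_simp; ring
        _ ≤ _ := this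
    refine (one_add_four_div_pow_le (by omega)).trans ?_
    rw [Real.exp_sub, div_eq_mul_inv]
    have h3 := inv_anti₀ (by positivity) h2
    rw [inv_div] at h3
    have := exp_four_le
    gcongr
  obtain ⟨p, rfl⟩ := Nat.exists_eq_add_of_le h
  have hp : (0 : ℝ) ≤ p := p.cast_nonneg
  push_cast at *
  calc (1 + 4 / (6 + (p : ℝ))) ^ (6 + p) * (6 + (p : ℝ) + 2) * (6 + (p : ℝ) + 4) ^ 3 / 128
      ≤ 55.04 * ((3 * (6 + p) + 8) / (3 * (6 + p) + 32)) * (6 + (p : ℝ) + 2)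
        * (6 + (p : ℝ) + 4) ^ 3 / 128 := by gcongr
    _ = 0.43 * ((3 * (6 + p) + 8) * (6 + (p : ℝ) + 2) * (6 + (p : ℝ) + 4) ^ 3)
        / (3 * (6 + p) + 32) := by ring
    _ ≤ _ := by
      rw [div_le_iff₀ (by positivity), ← sub_nonneg]
      ring_nf
      positivity

/-! ### Canonical representations and invariant families. -/

theorem norm_lt_one_of_mem {z : ℂ} (hz : z ∈ 𝔻) : ‖z‖ < 1 := by simpa using hz

theorem mem_disk_of_norm_lt {z : ℂ} (hz : ‖z‖ < 1) : z ∈ 𝔻 := by simpa using hz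

theorem zero_mem_disk : (0 : ℂ) ∈ 𝔻 := mem_disk_of_norm_lt (by simp)

theorem IsCanonicalRep.unique {f h g h₁ g₁ : ℂ → ℂ} (H : IsCanonicalRep f h g)
    (H₁ : IsCanonicalRep f h₁ g₁) : Set.EqOn h h₁ 𝔻 ∧ Set.EqOn g g₁ 𝔻 := by
  have hg : Set.EqOn g g₁ 𝔻 := by
    have huv : ∀ z ∈ 𝔻, h z - h₁ z = (starRingEnd ℂ) (g₁ z - g z) := by
      intro z hz
      have := (H.eq_add z hz).symm.trans (H₁.eq_add z hz)
      rw [map_sub]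
      linear_combination this
    have hd : ∀ z ∈ 𝔻, HasDerivAt (fun z => g₁ z - g z) 0 z := by
      intro z hz
      have hu := ((H.analytic_h z hz).differentiableAt.hasDerivAt.sub
        (H₁.analytic_h z hz).differentiableAt.hasDerivAt)
      have hv := ((H₁.analytic_g z hz).differentiableAt.hasDerivAt.sub
        (H.analytic_g z hz).differentiableAt.hasDerivAt)
      set u' := deriv h z - deriv h₁ z
      set v' := deriv g₁ z - deriv g z
      have hu' := hu.hasFDerivAt.restrictScalars ℝ
      have hv' := Complex.conjCLE.hasFDerivAt.comp z (hv.hasFDerivAt.restrictScalars ℝ)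
      -- The same function is holomorphic and antiholomorphic, so its real derivative is both
      -- complex linear and conjugate linear. Evaluating at `1` and `I` makes it zero.
      have hw := hu'.unique (hv'.congr_of_eventuallyEq (by
        filter_upwards [Metric.isOpen_ball.mem_nhds hz] with w hw
        simpa using huv w hw))
      have e1 := DFunLike.congr_fun hw 1
      have e2 := DFunLike.congr_fun hw Complex.I
      simp at e1 e2
      have : v' = 0 := by
        have e3 : Complex.I * u' = Complex.I * -u' := by
          rw [e2]; simp [e1]
        have e4 : u' = -u' := mul_left_cancel₀ Complex.I_ne_zero e3
        have e5 : u' = 0 := self_eq_neg.1 e4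
        rw [e5] at e1
        exact (map_eq_zero (starRingEnd ℂ)).1 e1.symm
      rwa [this] at hv
    intro z hz
    have := Metric.isOpen_ball.is_const_of_deriv_eq_zero
      (convex_ball (0 : ℂ) 1).isPreconnected
      (fun z hz => (hd z hz).differentiableAt.differentiableWithinAt)
      (fun z hz => (hd z hz).deriv) hz zero_mem_disk
    simp only [H.g_zero, H₁.g_zero, sub_self] at this
    exact (sub_eq_zero.1 this).symm
  refine ⟨fun z hz => ?_, hg⟩
  have := (H.eq_add z hz).symm.trans (H₁.eq_add z hz)
  rw [hg hz] at this
  exact add_right_cancel this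

theorem deriv_eqOn_disk {u v : ℂ → ℂ} (h : Set.EqOn u v 𝔻) : Set.EqOn (deriv u) (deriv v) 𝔻 :=
  h.deriv Metric.isOpen_ball

theorem IsNormalizedSensePreserving.of_rep {f h g : ℂ → ℂ} (hf : IsNormalizedSensePreserving f)
    (H : IsCanonicalRep f h g) :
    f 0 = 0 ∧ h 0 = 0 ∧ deriv h 0 = 1 ∧ ∀ z ∈ 𝔻, ‖deriv g z‖ < ‖deriv h z‖ := by
  obtain ⟨h₁, g₁, H₁, h0, h1, hJ⟩ := hf
  obtain ⟨e1, e2⟩ := H.unique H₁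
  refine ⟨h0, ?_, ?_, fun z hz => ?_⟩
  · have := H.eq_add 0 zero_mem_disk
    rw [h0, H.g_zero, map_zero, add_zero] at this
    exact this.symm
  · rw [deriv_eqOn_disk e1 zero_mem_disk, h1]
  · rw [deriv_eqOn_disk e1 hz, deriv_eqOn_disk e2 hz]
    have := hJ z hz
    exact lt_of_pow_lt_pow_left₀ 2 (norm_nonneg _) (by linarith)

theorem isNormalizedSensePreserving_of_mem_UH {α : ℝ} {f : ℂ → ℂ} (hf : f ∈ UH α) :
    IsNormalizedSensePreserving f := by
  obtain ⟨F, hF, -, hfF⟩ := hf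
  exact hF.normalized f hfF

theorem order_le_of_mem_UH {α : ℝ} {f h g : ℂ → ℂ} (hf : f ∈ UH α) (H : IsCanonicalRep f h g) :
    ‖taylorCoeff h 2 - (starRingEnd ℂ) (taylorCoeff g 1) * taylorCoeff g 2‖
      / (1 - ‖taylorCoeff g 1‖ ^ 2) ≤ α := by
  obtain ⟨F, -, hord, hfF⟩ := hf
  have := (le_sSup (show _ ∈ {q : EReal | ∃ f ∈ F, ∃ h g, IsCanonicalRep f h g ∧
    q = ((‖taylorCoeff h 2 - (starRingEnd ℂ) (taylorCoeff g 1) * taylorCoeff g 2‖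
      / (1 - ‖taylorCoeff g 1‖ ^ 2) : ℝ) : EReal)} from ⟨f, hfF, h, g, H, rfl⟩)).trans hord
  exact_mod_cast this

theorem koebeTransform_mem_UH {α : ℝ} {f h g : ℂ → ℂ} (hf : f ∈ UH α)
    (H : IsCanonicalRep f h g) (θ : ℝ) {a : ℂ} (ha : a ∈ 𝔻) : koebeTransform f h θ a ∈ UH α := by
  obtain ⟨F, hF, hord, hfF⟩ := hf
  exact ⟨F, hF, hord, hF.linear f hfF h g H θ a ha⟩

theorem affineChange_mem_UH {α : ℝ} {f h g : ℂ → ℂ} (hf : f ∈ UH α)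
    (H : IsCanonicalRep f h g) {ε : ℂ} (hε : ε ∈ 𝔻) : affineChange f g ε ∈ UH α := by
  obtain ⟨F, hF, hord, hfF⟩ := hf
  exact ⟨F, hF, hord, hF.affine f hfF h g H ε hε⟩

/-! ### Disk automorphisms, Koebe transforms and affine changes. -/

/-- The disk automorphism `z ↦ (z + a) / (1 + conj a * z)`. -/
noncomputable def diskShift (a z : ℂ) : ℂ := (z + a) / (1 + (starRingEnd ℂ) a * z)

theorem normSq_sub_normSq_diskShift (a z : ℂ) :
    ‖1 + (starRingEnd ℂ) a * z‖ ^ 2 - ‖z + a‖ ^ 2 = (1 - ‖a‖ ^ 2) * (1 - ‖z‖ ^ 2) := by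
  simp only [← Complex.normSq_eq_norm_sq, Complex.normSq_apply]
  simp
  ring

theorem one_add_conj_mul_ne_zero {a z : ℂ} (ha : a ∈ 𝔻) (hz : z ∈ 𝔻) :
    1 + (starRingEnd ℂ) a * z ≠ 0 := by
  intro h
  have h1 : ‖(starRingEnd ℂ) a * z‖ = 1 := by
    rw [eq_neg_of_add_eq_zero_right h, norm_neg, norm_one]
  rw [norm_mul, RCLike.norm_conj] at h1
  have := mul_lt_one_of_nonneg_of_lt_one_left (norm_nonneg a) (norm_lt_one_of_mem ha)
    (norm_lt_one_of_mem hz).le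
  linarith

theorem diskShift_mem {a z : ℂ} (ha : a ∈ 𝔻) (hz : z ∈ 𝔻) : diskShift a z ∈ 𝔻 := by
  apply mem_disk_of_norm_lt
  have h1 := norm_pos_iff.2 (one_add_conj_mul_ne_zero ha hz)
  rw [diskShift, norm_div, div_lt_one h1]
  have h2 := normSq_sub_normSq_diskShift a z
  have h3 : 0 < (1 - ‖a‖ ^ 2) * (1 - ‖z‖ ^ 2) := by
    have := norm_lt_one_of_mem ha
    have := norm_lt_one_of_mem hz
    have := norm_nonneg a
    have := norm_nonneg z
    apply mul_pos <;> nlinarith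
  exact lt_of_pow_lt_pow_left₀ 2 h1.le (by linarith)

@[simp] theorem diskShift_zero (a : ℂ) : diskShift a 0 = a := by simp [diskShift]

theorem one_sub_conj_mul_self (a : ℂ) :
    1 - (starRingEnd ℂ) a * a = ((1 - ‖a‖ ^ 2 : ℝ) : ℂ) := by
  rw [mul_comm, Complex.mul_conj, Complex.normSq_eq_norm_sq]
  push_cast
  rfl

theorem hasDerivAt_diskShift {a z : ℂ} (ha : a ∈ 𝔻) (hz : z ∈ 𝔻) :
    HasDerivAt (diskShift a) ((1 - ‖a‖ ^ 2 : ℝ) / (1 + (starRingEnd ℂ) a * z) ^ 2) z := by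
  have hne := one_add_conj_mul_ne_zero ha hz
  refine (((hasDerivAt_id z).add_const a).div
    (((hasDerivAt_id z).const_mul ((starRingEnd ℂ) a)).const_add 1) hne).congr_deriv ?_
  rw [← one_sub_conj_mul_self]
  simp only [id]
  congr 1
  ring

theorem analyticOnNhd_diskShift {a : ℂ} (ha : a ∈ 𝔻) : AnalyticOnNhd ℂ (diskShift a) 𝔻 :=
  DifferentiableOn.analyticOnNhd (fun _ hz =>
    (hasDerivAt_diskShift ha hz).differentiableAt.differentiableWithinAt) Metric.isOpen_ball

/-- The composition of `u` with a disk automorphism, vanishing at the origin and divided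
by `c`. -/
noncomputable def shiftQuotient (u : ℂ → ℂ) (a c : ℂ) : ℂ → ℂ := fun z =>
  (u (diskShift a z) - u a) / c

theorem analyticOnNhd_shiftQuotient {u : ℂ → ℂ} (hu : AnalyticOnNhd ℂ u 𝔻) {a : ℂ} (ha : a ∈ 𝔻)
    (c : ℂ) : AnalyticOnNhd ℂ (shiftQuotient u a c) 𝔻 := by
  intro z hz
  have h1 := (hu _ (diskShift_mem ha hz)).comp (analyticOnNhd_diskShift ha z hz)
  exact (h1.sub analyticAt_const).div_const

theorem hasDerivAt_shiftQuotient {u : ℂ → ℂ} (hu : AnalyticOnNhd ℂ u 𝔻) {a z : ℂ} (ha : a ∈ 𝔻)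
    (hz : z ∈ 𝔻) (c : ℂ) : HasDerivAt (shiftQuotient u a c)
      (deriv u (diskShift a z) * ((1 - ‖a‖ ^ 2 : ℝ) / (1 + (starRingEnd ℂ) a * z) ^ 2) / c) z :=
  (((hu _ (diskShift_mem ha hz)).differentiableAt.hasDerivAt.comp z
    (hasDerivAt_diskShift ha hz)).sub_const _).div_const _

theorem deriv_shiftQuotient_zero {u : ℂ → ℂ} (hu : AnalyticOnNhd ℂ u 𝔻) {a : ℂ} (ha : a ∈ 𝔻)
    (c : ℂ) : deriv (shiftQuotient u a c) 0 = deriv u a * (1 - ‖a‖ ^ 2 : ℝ) / c := by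
  rw [(hasDerivAt_shiftQuotient hu ha zero_mem_disk c).deriv]
  simp

theorem deriv_deriv_shiftQuotient_zero {u : ℂ → ℂ} (hu : AnalyticOnNhd ℂ u 𝔻) {a : ℂ}
    (ha : a ∈ 𝔻) (c : ℂ) : deriv (deriv (shiftQuotient u a c)) 0 =
      (deriv (deriv u) a * (1 - ‖a‖ ^ 2 : ℝ) ^ 2
        - 2 * (starRingEnd ℂ) a * (1 - ‖a‖ ^ 2 : ℝ) * deriv u a) / c := by
  have he : deriv (shiftQuotient u a c) =ᶠ[nhds 0] fun z =>
      deriv u (diskShift a z) * ((1 - ‖a‖ ^ 2 : ℝ) / (1 + (starRingEnd ℂ) a * z) ^ 2) / c := by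
    filter_upwards [Metric.isOpen_ball.mem_nhds zero_mem_disk] with z hz
    exact (hasDerivAt_shiftQuotient hu ha hz c).deriv
  rw [he.deriv_eq]
  have h1 := (hu.deriv _ (diskShift_mem ha zero_mem_disk)).differentiableAt.hasDerivAt.comp 0
    (hasDerivAt_diskShift ha zero_mem_disk)
  have h2 := (((hasDerivAt_id (0 : ℂ)).const_mul ((starRingEnd ℂ) a)).const_add 1).pow 2
  have h3 := (hasDerivAt_const (0 : ℂ) ((1 - ‖a‖ ^ 2 : ℝ) : ℂ)).div h2 (by simp)
  refine ((h1.mul h3).div_const c).deriv.trans ?_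
  simp
  ring

theorem IsCanonicalRep.koebeTransform {f h g : ℂ → ℂ} (H : IsCanonicalRep f h g) {a : ℂ}
    (ha : a ∈ 𝔻) : IsCanonicalRep (koebeTransform f h 0 a)
      (shiftQuotient h a ((1 - ‖a‖ ^ 2 : ℝ) * deriv h a))
      (shiftQuotient g a ((starRingEnd ℂ) ((1 - ‖a‖ ^ 2 : ℝ) * deriv h a))) where
  analytic_h := analyticOnNhd_shiftQuotient H.analytic_h ha _
  analytic_g := analyticOnNhd_shiftQuotient H.analytic_g ha _
  g_zero := by simp [shiftQuotient]
  eq_add z hz := by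
    have h1 := H.eq_add _ (diskShift_mem ha hz)
    have h2 := H.eq_add a ha
    simp only [HarmonicSections.koebeTransform, Complex.ofReal_zero, mul_zero, Complex.exp_zero,
      one_mul, mul_one, shiftQuotient, map_div₀, map_sub, Complex.conj_conj]
    rw [diskShift] at h1
    rw [h1, h2, diskShift]
    push_cast
    ring

theorem IsCanonicalRep.affineChange {f h g : ℂ → ℂ} (H : IsCanonicalRep f h g) (h0 : h 0 = 0)
    (ε : ℂ) : IsCanonicalRep (affineChange f g ε)
      (fun z => (h z + ε * g z) / (1 + ε * deriv g 0))
      (fun z => (g z + (starRingEnd ℂ) ε * h z) / (starRingEnd ℂ) (1 + ε * deriv g 0)) where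
  analytic_h := (H.analytic_h.add (analyticOnNhd_const.mul H.analytic_g)).div_const
  analytic_g := (H.analytic_g.add (analyticOnNhd_const.mul H.analytic_h)).div_const
  g_zero := by simp [h0, H.g_zero]
  eq_add z hz := by
    simp only [HarmonicSections.affineChange, H.eq_add z hz, map_div₀, map_add, map_mul,
      Complex.conj_conj]
    ring

theorem taylorCoeff_one (u : ℂ → ℂ) : taylorCoeff u 1 = deriv u 0 := by
  simp [taylorCoeff]

theorem taylorCoeff_two (u : ℂ → ℂ) : taylorCoeff u 2 = deriv (deriv u) 0 / 2 := by
  simp [taylorCoeff, iteratedDeriv_succ]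

/-! ### Distortion of the Jacobian and of the derivatives. -/

/-- The bound for the logarithmic derivative of the Jacobian which follows from linear
invariance. -/
theorem norm_logDeriv_jacobian_le {α : ℝ} {f h g : ℂ → ℂ} (hf : f ∈ UH α)
    (H : IsCanonicalRep f h g) {a : ℂ} (ha : a ∈ 𝔻) :
    ‖(1 - ‖a‖ ^ 2 : ℝ) * (deriv (deriv h) a * (starRingEnd ℂ) (deriv h a)
        - deriv (deriv g) a * (starRingEnd ℂ) (deriv g a))
      - 2 * (starRingEnd ℂ) a * ((‖deriv h a‖ ^ 2 - ‖deriv g a‖ ^ 2 : ℝ) : ℂ)‖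
      ≤ 2 * α * (‖deriv h a‖ ^ 2 - ‖deriv g a‖ ^ 2) := by
  have hlt := ((isNormalizedSensePreserving_of_mem_UH hf).of_rep H).2.2.2 a ha
  have hh : deriv h a ≠ 0 := by
    intro h0
    rw [h0, norm_zero] at hlt
    exact absurd (norm_nonneg (deriv g a)) (not_le.2 hlt)
  have hs : (0 : ℝ) < 1 - ‖a‖ ^ 2 := by
    have := norm_lt_one_of_mem ha
    nlinarith [norm_nonneg a]
  have hs' : ((1 - ‖a‖ ^ 2 : ℝ) : ℂ) ≠ 0 := by exact_mod_cast hs.ne'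
  -- The order bound for the Koebe transform centred at `a`, read back as a statement about `f` at
  -- `a`. No rotation is needed.
  have hord := order_le_of_mem_UH (koebeTransform_mem_UH hf H 0 ha) (H.koebeTransform ha)
  rw [taylorCoeff_one, taylorCoeff_two, taylorCoeff_two, deriv_shiftQuotient_zero H.analytic_g ha,
    deriv_deriv_shiftQuotient_zero H.analytic_g ha,
    deriv_deriv_shiftQuotient_zero H.analytic_h ha] at hord
  set s := (1 - ‖a‖ ^ 2 : ℝ)
  set p := deriv h a
  set q := deriv g a
  have hp' : (starRingEnd ℂ) p ≠ 0 := (map_ne_zero _).2 hh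
  have hJ : 0 < ‖p‖ ^ 2 - ‖q‖ ^ 2 := by
    have := norm_nonneg q
    nlinarith
  have hb1 : q * s / (starRingEnd ℂ) (s * p) = q / (starRingEnd ℂ) p := by
    rw [map_mul, Complex.conj_ofReal]; field_simp
  have hnorm : ((‖p‖ ^ 2 : ℝ) : ℂ) = p * (starRingEnd ℂ) p := by
    rw [Complex.mul_conj, Complex.normSq_eq_norm_sq]
  have hnormq : ((‖q‖ ^ 2 : ℝ) : ℂ) = q * (starRingEnd ℂ) q := by
    rw [Complex.mul_conj, Complex.normSq_eq_norm_sq]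
  rw [hb1] at hord
  have hp0 : 0 < ‖p‖ := norm_pos_iff.2 hh
  have hden : 1 - ‖q / (starRingEnd ℂ) p‖ ^ 2 = (‖p‖ ^ 2 - ‖q‖ ^ 2) / ‖p‖ ^ 2 := by
    rw [norm_div, RCLike.norm_conj]; field_simp
  rw [hden, div_le_iff₀ (by positivity)] at hord
  have hnum : (deriv (deriv h) a * (s : ℂ) ^ 2 - 2 * (starRingEnd ℂ) a * s * p) / (s * p) / 2
      - (starRingEnd ℂ) (q / (starRingEnd ℂ) p)
        * ((deriv (deriv g) a * (s : ℂ) ^ 2 - 2 * (starRingEnd ℂ) a * s * q)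
          / (starRingEnd ℂ) (s * p) / 2)
      = (s * (deriv (deriv h) a * (starRingEnd ℂ) p - deriv (deriv g) a * (starRingEnd ℂ) q)
        - 2 * (starRingEnd ℂ) a * ((‖p‖ ^ 2 - ‖q‖ ^ 2 : ℝ) : ℂ)) / (2 * (‖p‖ ^ 2 : ℝ)) := by
    rw [Complex.ofReal_sub (‖p‖ ^ 2), hnormq, hnorm, map_mul, Complex.conj_ofReal, map_div₀,
      Complex.conj_conj]
    field_simp
    ring
  rw [hnum, norm_div] at hord
  have h2 : ‖(2 : ℂ) * ((‖p‖ ^ 2 : ℝ) : ℂ)‖ = 2 * ‖p‖ ^ 2 := by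
    rw [norm_mul, Complex.norm_real, Real.norm_of_nonneg (by positivity)]; norm_num
  rw [h2, div_le_iff₀ (by positivity)] at hord
  refine hord.trans (le_of_eq ?_)
  field_simp

/-- The hypothesis puts `d/j` between `(4ρ - 10)/(1 - ρ²)` and `(4ρ + 10)/(1 - ρ²)`, the logarithmic
derivatives of the two asserted bounds. The constant 10 is `4α` for `α = 5/2`. Multiplying `j` by
the reciprocal of each bound gives monotone functions. -/
theorem growth_of_logDeriv_bound {j d : ℝ → ℝ} (h0 : j 0 = 1)
    (hd : ∀ ρ ∈ Set.Ico (0 : ℝ) 1, HasDerivAt j (d ρ) ρ)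
    (hb : ∀ ρ ∈ Set.Ico (0 : ℝ) 1, |(1 - ρ ^ 2) * d ρ - 4 * ρ * j ρ| ≤ 10 * j ρ)
    {r : ℝ} (hr : r ∈ Set.Ico (0 : ℝ) 1) :
    (1 - r) ^ 3 / (1 + r) ^ 7 ≤ j r ∧ j r ≤ (1 + r) ^ 3 / (1 - r) ^ 7 := by
  have hzero : (0 : ℝ) ∈ Set.Ico (0 : ℝ) 1 := by norm_num
  have hr0 := hr.1
  have hr1 : 0 < 1 - r := by linarith [hr.2]
  have hmono' : ∀ (k l : ℕ), ∀ ρ ∈ Set.Ico (0 : ℝ) 1,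
      HasDerivAt (fun ρ => j ρ * (1 + ρ) ^ (k + 1) / (1 - ρ) ^ (l + 1))
      ((1 + ρ) ^ k / (1 - ρ) ^ (l + 2) * (d ρ * ((1 - ρ) * (1 + ρ))
        + j ρ * ((k + 1) * (1 - ρ) + (l + 1) * (1 + ρ)))) ρ := by
    intro k l ρ hρ
    have hne : (1 : ℝ) - ρ ≠ 0 := by linarith [hρ.2]
    refine (((hd ρ hρ).mul (((hasDerivAt_id ρ).const_add 1).pow (k + 1))).div
      (((hasDerivAt_id ρ).const_sub 1).pow (l + 1)) (by simpa using hne)).congr_deriv ?_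
    simp
    field_simp
    ring
  have hanti' : ∀ (k l : ℕ), ∀ ρ ∈ Set.Ico (0 : ℝ) 1,
      HasDerivAt (fun ρ => j ρ * (1 - ρ) ^ (k + 1) / (1 + ρ) ^ (l + 1))
      ((1 - ρ) ^ k / (1 + ρ) ^ (l + 2) * (d ρ * ((1 - ρ) * (1 + ρ))
        - j ρ * ((k + 1) * (1 + ρ) + (l + 1) * (1 - ρ)))) ρ := by
    intro k l ρ hρ
    have hne : (1 : ℝ) + ρ ≠ 0 := by linarith [hρ.1]
    refine (((hd ρ hρ).mul (((hasDerivAt_id ρ).const_sub 1).pow (k + 1))).div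
      (((hasDerivAt_id ρ).const_add 1).pow (l + 1)) (by simpa using hne)).congr_deriv ?_
    simp
    field_simp
    ring
  constructor
  · have hmono : MonotoneOn (fun ρ => j ρ * (1 + ρ) ^ (6 + 1) / (1 - ρ) ^ (2 + 1))
        (Set.Ico 0 1) := by
      refine monotoneOn_of_hasDerivWithinAt_nonneg (convex_Ico 0 1)
        (fun x hx => (hmono' 6 2 x hx).continuousAt.continuousWithinAt)
        (fun x hx => (hmono' 6 2 x (interior_subset hx)).hasDerivWithinAt) fun x hx => ?_
      have hx := interior_subset hx
      have h1 := (abs_le.1 (hb x hx)).1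
      have h2 := hx.1
      have h3 : 0 < 1 - x := by linarith [hx.2]
      refine mul_nonneg (by positivity) ?_
      push_cast
      nlinarith
    have := hmono hzero hr hr0
    simp only [h0] at this
    norm_num at this
    rw [le_div_iff₀ (by positivity)] at this
    rw [div_le_iff₀ (by positivity)]
    linarith
  · have hanti : AntitoneOn (fun ρ => j ρ * (1 - ρ) ^ (6 + 1) / (1 + ρ) ^ (2 + 1))
        (Set.Ico 0 1) := by
      refine antitoneOn_of_hasDerivWithinAt_nonpos (convex_Ico 0 1)
        (fun x hx => (hanti' 6 2 x hx).continuousAt.continuousWithinAt)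
        (fun x hx => (hanti' 6 2 x (interior_subset hx)).hasDerivWithinAt) fun x hx => ?_
      have hx := interior_subset hx
      have h1 := (abs_le.1 (hb x hx)).2
      have h2 := hx.1
      have h3 : 0 < 1 - x := by linarith [hx.2]
      refine mul_nonpos_of_nonneg_of_nonpos (by positivity) ?_
      push_cast
      nlinarith
    have := hanti hzero hr hr0
    simp only [h0] at this
    norm_num at this
    rw [div_le_iff₀ (by positivity)] at this
    rw [le_div_iff₀ (by positivity)]
    linarith

theorem hasDerivAt_normSq_radial {u : ℂ → ℂ} (hu : AnalyticOnNhd ℂ u 𝔻) {ζ : ℂ} {ρ : ℝ}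
    (hρ : (ρ : ℂ) * ζ ∈ 𝔻) :
    HasDerivAt (fun ρ : ℝ => ‖u (ρ * ζ)‖ ^ 2)
      (2 * (ζ * (deriv u (ρ * ζ) * (starRingEnd ℂ) (u (ρ * ζ)))).re) ρ := by
  have h1 : HasDerivAt (fun w : ℂ => u (w * ζ)) (deriv u (ρ * ζ) * ζ) (ρ : ℂ) := by
    have := ((hu _ hρ).differentiableAt.hasDerivAt).comp (ρ : ℂ)
      ((hasDerivAt_id (ρ : ℂ)).mul_const ζ)
    simpa [Function.comp_def] using this
  refine h1.comp_ofReal.norm_sq.congr_deriv ?_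
  rw [Complex.inner]
  congr 2
  ring

theorem jacobian_bounds {f h g : ℂ → ℂ} (hf : f ∈ UH (5 / 2)) (H : IsCanonicalRep f h g)
    (hg : deriv g 0 = 0) {z : ℂ} (hz : z ∈ 𝔻) :
    (1 - ‖z‖) ^ 3 / (1 + ‖z‖) ^ 7 ≤ ‖deriv h z‖ ^ 2 - ‖deriv g z‖ ^ 2 ∧
      ‖deriv h z‖ ^ 2 - ‖deriv g z‖ ^ 2 ≤ (1 + ‖z‖) ^ 3 / (1 - ‖z‖) ^ 7 := by
  obtain ⟨ζ, hζ, hzζ⟩ : ∃ ζ : ℂ, ‖ζ‖ = 1 ∧ z = (‖z‖ : ℂ) * ζ := by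
    rcases eq_or_ne z 0 with rfl | h0
    · exact ⟨1, by simp, by simp⟩
    · have : (‖z‖ : ℂ) ≠ 0 := by exact_mod_cast norm_ne_zero_iff.2 h0
      exact ⟨z / ‖z‖, by simp [h0], by field_simp⟩
  have hmem : ∀ ρ ∈ Set.Ico (0 : ℝ) 1, (ρ : ℂ) * ζ ∈ 𝔻 := fun ρ hρ =>
    mem_disk_of_norm_lt (by rw [norm_mul, hζ, mul_one, Complex.norm_real,
      Real.norm_of_nonneg hρ.1]; exact hρ.2)
  have h1 := ((isNormalizedSensePreserving_of_mem_UH hf).of_rep H).2.2.1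
  have := growth_of_logDeriv_bound
    (j := fun ρ : ℝ => ‖deriv h (ρ * ζ)‖ ^ 2 - ‖deriv g (ρ * ζ)‖ ^ 2)
    (d := fun ρ : ℝ => 2 * (ζ * (deriv (deriv h) (ρ * ζ) * (starRingEnd ℂ) (deriv h (ρ * ζ)))).re
      - 2 * (ζ * (deriv (deriv g) (ρ * ζ) * (starRingEnd ℂ) (deriv g (ρ * ζ)))).re)
    (by simp [h1, hg])
    (fun ρ hρ => (hasDerivAt_normSq_radial H.analytic_h.deriv (hmem ρ hρ)).sub
      (hasDerivAt_normSq_radial H.analytic_g.deriv (hmem ρ hρ)))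
    (fun ρ hρ => ?_) (r := ‖z‖) ⟨norm_nonneg z, norm_lt_one_of_mem hz⟩
  · rw [← hzζ] at this
    exact this
  · have hb := norm_logDeriv_jacobian_le hf H (hmem ρ hρ)
    have hn : ‖(ρ : ℂ) * ζ‖ = ρ := by
      rw [norm_mul, hζ, mul_one, Complex.norm_real, Real.norm_of_nonneg hρ.1]
    rw [hn] at hb
    have hζζ : ζ * (starRingEnd ℂ) ζ = 1 := by
      rw [Complex.mul_conj, Complex.normSq_eq_norm_sq, hζ]; norm_num
    set J := ‖deriv h (ρ * ζ)‖ ^ 2 - ‖deriv g (ρ * ζ)‖ ^ 2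
    set N := deriv (deriv h) (ρ * ζ) * (starRingEnd ℂ) (deriv h (ρ * ζ))
    set M := deriv (deriv g) (ρ * ζ) * (starRingEnd ℂ) (deriv g (ρ * ζ))
    have hre := (Complex.abs_re_le_norm (ζ * ((1 - ρ ^ 2 : ℝ) * (N - M)
      - 2 * (starRingEnd ℂ) (ρ * ζ) * (J : ℂ)))).trans_eq (norm_mul _ _)
    rw [hζ, one_mul] at hre
    have he : ζ * ((1 - ρ ^ 2 : ℝ) * (N - M) - 2 * (starRingEnd ℂ) (ρ * ζ) * (J : ℂ))
        = ((1 - ρ ^ 2 : ℝ) : ℂ) * (ζ * N - ζ * M) - ((2 * ρ * J : ℝ) : ℂ) := by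
      rw [map_mul, Complex.conj_ofReal]
      push_cast
      linear_combination (-2 * (ρ : ℂ) * J) * hζζ
    rw [he, Complex.sub_re, Complex.re_ofReal_mul, Complex.ofReal_re, Complex.sub_re] at hre
    have h3 := hre.trans hb
    rw [abs_le] at h3 ⊢
    constructor <;> nlinarith [h3.1, h3.2]

/-- The Schwarz lemma for the dilatation `g'/h'`, which maps the disk into itself and vanishes at 0.
-/
theorem norm_deriv_coanalytic_le {f h g : ℂ → ℂ} (hf : IsNormalizedSensePreserving f)
    (H : IsCanonicalRep f h g) (hg : deriv g 0 = 0) {z : ℂ} (hz : z ∈ 𝔻) :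
    ‖deriv g z‖ ≤ ‖z‖ * ‖deriv h z‖ := by
  have hlt := (hf.of_rep H).2.2.2
  have hpos : ∀ w ∈ 𝔻, 0 < ‖deriv h w‖ := fun w hw => (norm_nonneg _).trans_lt (hlt w hw)
  have := Complex.norm_le_norm_of_mapsTo_ball (f := fun w => deriv g w / deriv h w) (R := 1)
    (z := z) (fun w hw => ((H.analytic_g.deriv w hw).div (H.analytic_h.deriv w hw)
      (norm_pos_iff.1 (hpos w hw))).differentiableAt.differentiableWithinAt)
    (fun w hw => by
      rw [mem_closedBall_zero_iff, norm_div]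
      exact (div_le_one (hpos w hw)).2 (hlt w hw).le)
    (by simp [hg]) (norm_lt_one_of_mem hz)
  rwa [norm_div, div_le_iff₀ (hpos z hz)] at this

theorem norm_deriv_analytic_le {f h g : ℂ → ℂ} (hf : f ∈ UH (5 / 2)) (H : IsCanonicalRep f h g)
    (hg : deriv g 0 = 0) {z : ℂ} (hz : z ∈ 𝔻) :
    ‖deriv h z‖ ≤ (1 + ‖z‖) / (1 - ‖z‖) ^ 4 := by
  have hJ := (jacobian_bounds hf H hg hz).2
  have hS := norm_deriv_coanalytic_le (isNormalizedSensePreserving_of_mem_UH hf) H hg hz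
  have hr0 := norm_nonneg z
  have hr1 : 0 < 1 - ‖z‖ := by linarith [norm_lt_one_of_mem hz]
  have hp := norm_nonneg (deriv h z)
  have hq := norm_nonneg (deriv g z)
  set r := ‖z‖
  set p := ‖deriv h z‖
  set q := ‖deriv g z‖
  refine le_of_sq_le_sq ?_ (by positivity)
  have h1 : q ^ 2 ≤ r ^ 2 * p ^ 2 := by
    rw [← mul_pow]; gcongr
  have h2 : p ^ 2 * ((1 - r) * (1 + r)) ≤ (1 + r) ^ 3 / (1 - r) ^ 7 := by linarith
  calc p ^ 2 ≤ (1 + r) ^ 3 / (1 - r) ^ 7 / ((1 - r) * (1 + r)) := by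
        rwa [le_div_iff₀ (by positivity)]
    _ = ((1 + r) / (1 - r) ^ 4) ^ 2 := by field_simp

theorem le_norm_deriv_sub_norm_deriv {f h g : ℂ → ℂ} (hf : f ∈ UH (5 / 2))
    (H : IsCanonicalRep f h g) (hg : deriv g 0 = 0) {z : ℂ} (hz : z ∈ 𝔻) :
    (1 - ‖z‖) ^ 2 / (1 + ‖z‖) ^ 4 ≤ ‖deriv h z‖ - ‖deriv g z‖ := by
  have hJ := (jacobian_bounds hf H hg hz).1
  have hn := isNormalizedSensePreserving_of_mem_UH hf
  have hS := norm_deriv_coanalytic_le hn H hg hz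
  have hlt := (hn.of_rep H).2.2.2 z hz
  have hr0 := norm_nonneg z
  have hr1 : 0 < 1 - ‖z‖ := by linarith [norm_lt_one_of_mem hz]
  have hq := norm_nonneg (deriv g z)
  set r := ‖z‖
  set p := ‖deriv h z‖
  set q := ‖deriv g z‖
  refine le_of_sq_le_sq ?_ (by linarith)
  -- Equivalent to `q ≤ r p`. It converts the bound on `(p - q)(p + q)` into one on `(p - q)²`.
  have h1 : (1 - r) * (p + q) ≤ (1 + r) * (p - q) := by nlinarith
  have h2 : (1 - r) * (p ^ 2 - q ^ 2) ≤ (1 + r) * (p - q) ^ 2 := by nlinarith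
  rw [div_le_iff₀ (by positivity)] at hJ
  rw [div_pow, div_le_iff₀ (by positivity)]
  have h3 : (1 - r) * (1 - r) ^ 3 ≤ (1 - r) * ((p ^ 2 - q ^ 2) * (1 + r) ^ 7) := by gcongr
  have h4 : (1 - r) * (p ^ 2 - q ^ 2) * (1 + r) ^ 7 ≤ (1 + r) * (p - q) ^ 2 * (1 + r) ^ 7 := by
    gcongr
  nlinarith

/-! ### Coefficient bounds. -/

theorem norm_taylorCoeff_le {u : ℂ → ℂ} (hu : AnalyticOnNhd ℂ u 𝔻) {r M : ℝ} (hr0 : 0 < r)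
    (hr1 : r < 1) (hM : ∀ z : ℂ, ‖z‖ = r → ‖deriv u z‖ ≤ M) (k : ℕ) :
    ((k : ℝ) + 1) * ‖taylorCoeff u (k + 1)‖ ≤ M / r ^ k := by
  have hd : DiffContOnCl ℂ (deriv u) (Metric.ball 0 r) := by
    apply DifferentiableOn.diffContOnCl
    rw [closure_ball _ hr0.ne']
    intro z hz
    exact (hu.deriv z (Metric.closedBall_subset_ball hr1 hz)).differentiableAt.differentiableWithinAt
  have := Complex.norm_iteratedDeriv_le_of_forall_mem_sphere_norm_le k hr0 hd
    (fun z hz => hM z (by simpa using hz))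
  rw [← iteratedDeriv_succ'] at this
  rw [taylorCoeff, norm_div, Complex.norm_natCast, Nat.factorial_succ]
  have hk : (0 : ℝ) < k.factorial := by exact_mod_cast k.factorial_pos
  push_cast
  calc ((k : ℝ) + 1) * (‖iteratedDeriv (k + 1) u 0‖ / ((k + 1) * k.factorial))
      = ‖iteratedDeriv (k + 1) u 0‖ / k.factorial := by field_simp
    _ ≤ (k.factorial * M / r ^ k) / k.factorial := by gcongr
    _ = M / r ^ k := by field_simp

theorem norm_taylorCoeff_analytic_le {f h g : ℂ → ℂ} (hf : f ∈ UH (5 / 2))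
    (H : IsCanonicalRep f h g) (hg : deriv g 0 = 0) {k : ℕ} (hk : 2 ≤ k) :
    (k : ℝ) * ‖taylorCoeff h k‖ ≤ 3 / 4 * (k : ℝ) ^ 4 := by
  obtain ⟨q, rfl⟩ : ∃ q, k = q + 1 := ⟨k - 1, by omega⟩
  rcases Nat.lt_or_ge q 2 with hq | hq
  -- For `k = 2` the Cauchy estimate below would give `1875/128 > 12`; the order gives `2 |a₂| ≤ 5`.
  · obtain rfl : q = 1 := by omega
    have := order_le_of_mem_UH hf H
    rw [taylorCoeff_one, hg] at this
    norm_num at this ⊢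
    linarith
  have hq0 : (2 : ℝ) ≤ q := by exact_mod_cast hq
  have hq1 : (0 : ℝ) < q := by linarith
  have hr1 : (q : ℝ) / (q + 4) < 1 := by rw [div_lt_one (by positivity)]; linarith
  -- The radius `q/(q+4)` minimizes `r^{-q} (1 - r)^{-4}`.
  have := norm_taylorCoeff_le H.analytic_h (r := q / (q + 4))
    (M := (1 + q / (q + 4)) / (1 - q / (q + 4)) ^ 4) (by positivity) hr1 (fun z hz => by
      rw [← hz]
      exact norm_deriv_analytic_le hf H hg (mem_disk_of_norm_lt (by rwa [hz]))) q
  push_cast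
  refine this.trans ?_
  have e : 1 - (q : ℝ) / (q + 4) = 4 / (q + 4) := by field_simp; ring
  have e2 : 1 + 4 / (q : ℝ) = (q + 4) / q := by field_simp
  have hb := analytic_coeff_bound hq
  rw [e2, div_pow] at hb
  rw [e]
  simp only [div_pow]
  refine le_trans (le_of_eq ?_) hb
  field_simp
  ring

theorem norm_taylorCoeff_coanalytic_le {f h g : ℂ → ℂ} (hf : f ∈ UH (5 / 2))
    (H : IsCanonicalRep f h g) (hg : deriv g 0 = 0) {k : ℕ} (hk : 3 ≤ k) :
    (k : ℝ) * ‖taylorCoeff g k‖ ≤ 43 / 100 * (k : ℝ) ^ 4 := by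
  -- The Schwarz factor `|z|` lowers the power of `1/r` by one, hence `p = k - 2`. The optimal
  -- radius `p/(p+4)` is positive only for `k ≥ 3`, the range needed when `m ≥ 2`.
  obtain ⟨p, rfl⟩ : ∃ p, k = p + 1 + 1 := ⟨k - 2, by omega⟩
  have hp : 1 ≤ p := by omega
  have hp0 : (1 : ℝ) ≤ p := by exact_mod_cast hp
  have hp1 : (0 : ℝ) < p := by linarith
  have hr1 : (p : ℝ) / (p + 4) < 1 := by rw [div_lt_one (by positivity)]; linarith
  have := norm_taylorCoeff_le H.analytic_g (r := p / (p + 4))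
    (M := p / (p + 4) * ((1 + p / (p + 4)) / (1 - p / (p + 4)) ^ 4)) (by positivity) hr1
    (fun z hz => by
      have hz' : z ∈ 𝔻 := mem_disk_of_norm_lt (by rwa [hz])
      have h1 := norm_deriv_coanalytic_le (isNormalizedSensePreserving_of_mem_UH hf) H hg hz'
      have h2 := norm_deriv_analytic_le hf H hg hz'
      rw [hz] at h1 h2
      refine h1.trans ?_
      gcongr) (p + 1)
  push_cast at *
  refine this.trans ?_
  have e : 1 - (p : ℝ) / (p + 4) = 4 / (p + 4) := by field_simp; ring
  have e2 : 1 + 4 / (p : ℝ) = (p + 4) / p := by field_simp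
  have hb := coanalytic_coeff_bound hp
  rw [e2, div_pow] at hb
  rw [e]
  simp only [div_pow]
  have hb2 := mul_le_mul_of_nonneg_right hb (show 0 ≤ (p : ℝ) + 2 by positivity)
  refine le_trans (le_of_eq ?_) (hb2.trans (le_of_eq ?_))
  · field_simp
    ring
  · ring

/-! ### The growth theorem. -/

/-- The lower bound for the modulus of the univalent members of the family that are normalized
by `f_{z̄}(0) = 0`. -/
noncomputable def growthBound (r : ℝ) : ℝ := (1 - ((1 - r) / (1 + r)) ^ 3) / 6

@[simp] theorem growthBound_zero : growthBound 0 = 0 := by simp [growthBound]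

/-- `growthBound` is a primitive of the decreasing function `(1 - r)² / (1 + r)⁴`, hence concave. In
the variable `(1 - r)/(1 + r)` the gap to the tangent is `(x - y)²` times a positive factor. -/
theorem growthBound_le_tangent {a b : ℝ} (ha : 0 ≤ a) (ha' : a < 1) (hb : 0 ≤ b) (hb' : b < 1) :
    growthBound b ≤ growthBound a + (1 - a) ^ 2 / (1 + a) ^ 4 * (b - a) := by
  obtain ⟨x, hx, rfl⟩ : ∃ x, 0 < x ∧ a = (1 - x) / (1 + x) := by
    have h1 : 0 < 1 - a := by linarith
    exact ⟨(1 - a) / (1 + a), by positivity, by field_simp; ring⟩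
  obtain ⟨y, hy, rfl⟩ : ∃ y, 0 < y ∧ b = (1 - y) / (1 + y) := by
    have h1 : 0 < 1 - b := by linarith
    exact ⟨(1 - b) / (1 + b), by positivity, by field_simp; ring⟩
  have e : ∀ x : ℝ, 0 < x → (1 - (1 - x) / (1 + x)) / (1 + (1 - x) / (1 + x)) = x := by
    intro x hx
    have : 1 + (1 - x) / (1 + x) = 2 / (1 + x) := by field_simp; ring
    rw [this]
    field_simp
    ring
  have e2 : (1 - (1 - x) / (1 + x)) ^ 2 / (1 + (1 - x) / (1 + x)) ^ 4
      = x ^ 2 * (1 + x) ^ 2 / 4 := by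
    have h1 : 1 + (1 - x) / (1 + x) = 2 / (1 + x) := by field_simp; ring
    have h2 : 1 - (1 - x) / (1 + x) = 2 * x / (1 + x) := by field_simp; ring
    rw [h1, h2]
    field_simp
    ring
  rw [growthBound, growthBound, e x hx, e y hy, e2, ← sub_nonneg]
  have : (1 - x ^ 3) / 6 + x ^ 2 * (1 + x) ^ 2 / 4 * ((1 - y) / (1 + y) - (1 - x) / (1 + x))
      - (1 - y ^ 3) / 6
      = (x - y) ^ 2 * (2 * x + y + 3 * x ^ 2 + 2 * x * y + y ^ 2) / (6 * (1 + y)) := by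
    field_simp
    ring
  rw [this]
  positivity

theorem growthBound_mul_le {s t : ℝ} (hs : 0 < s) (hst : s ≤ t) (ht : t < 1) :
    growthBound t * s ≤ growthBound s * t := by
  have h1 := growthBound_le_tangent hs.le (hst.trans_lt ht) le_rfl zero_lt_one
  have h2 := growthBound_le_tangent hs.le (hst.trans_lt ht) (hs.le.trans hst) ht
  rw [growthBound_zero] at h1
  set d := (1 - s) ^ 2 / (1 + s) ^ 4
  nlinarith [mul_le_mul_of_nonneg_left h2 hs.le, mul_nonneg (sub_nonneg.2 hst) (sub_nonneg.2 h1)]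

theorem continuousOn_growthBound : ContinuousOn growthBound (Set.Ici 0) := by
  unfold growthBound
  have : ContinuousOn (fun r : ℝ => (1 - r) / (1 + r)) (Set.Ici 0) :=
    ContinuousOn.div (by fun_prop) (by fun_prop) fun x hx => by linarith [Set.mem_Ici.1 hx]
  exact (continuousOn_const.sub (this.pow 3)).div_const 6

theorem IsCanonicalRep.continuousOn {f h g : ℂ → ℂ} (H : IsCanonicalRep f h g) :
    ContinuousOn f 𝔻 :=
  (H.analytic_h.continuousOn.add
    (Complex.continuous_conj.comp_continuousOn H.analytic_g.continuousOn)).congr H.eq_add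

/-- The real derivative of a harmonic mapping of the disk. -/
theorem IsCanonicalRep.exists_hasStrictFDerivAt {f h g : ℂ → ℂ} (H : IsCanonicalRep f h g)
    {z : ℂ} (hz : z ∈ 𝔻) : ∃ A : ℂ →L[ℝ] ℂ, HasStrictFDerivAt f A z ∧
      ∀ v, (‖deriv h z‖ - ‖deriv g z‖) * ‖v‖ ≤ ‖A v‖ := by
  have hh := (H.analytic_h z hz).hasStrictDerivAt.hasStrictFDerivAt.restrictScalars ℝ
  have hg := Complex.conjCLE.hasStrictFDerivAt.comp z
    ((H.analytic_g z hz).hasStrictDerivAt.hasStrictFDerivAt.restrictScalars ℝ)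
  refine ⟨_, (hh.add hg).congr_of_eventuallyEq ?_, fun v => ?_⟩
  · filter_upwards [Metric.isOpen_ball.mem_nhds hz] with w hw
    simpa using (H.eq_add w hw).symm
  · have h1 : ‖v * deriv h z‖ - ‖(starRingEnd ℂ) (v * deriv g z)‖
        ≤ ‖v * deriv h z + (starRingEnd ℂ) (v * deriv g z)‖ := by
      have := norm_sub_norm_le (v * deriv h z) (-(starRingEnd ℂ) (v * deriv g z))
      rwa [norm_neg, sub_neg_eq_add] at this
    rw [RCLike.norm_conj, norm_mul, norm_mul] at h1
    have h2 : (‖deriv h z‖ - ‖deriv g z‖) * ‖v‖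
        ≤ ‖v * deriv h z + (starRingEnd ℂ) (v * deriv g z)‖ := by linarith
    simpa using h2

/-- The growth theorem: a lower bound for the minimal stretching of an injective harmonic mapping
integrates to a lower bound for its modulus. -/
theorem growthBound_le_norm {f h g : ℂ → ℂ} (H : IsCanonicalRep f h g) (hinj : Set.InjOn f 𝔻)
    (h0 : f 0 = 0)
    (hl : ∀ z ∈ 𝔻, (1 - ‖z‖) ^ 2 / (1 + ‖z‖) ^ 4 ≤ ‖deriv h z‖ - ‖deriv g z‖)
    {z₀ : ℂ} (hz₀ : z₀ ∈ 𝔻) : growthBound ‖z₀‖ ≤ ‖f z₀‖ := by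
  by_contra! hlt
  set r := ‖z₀‖ with hr
  set w := f z₀ with hw
  have hr1 : r < 1 := norm_lt_one_of_mem hz₀
  -- The slack `C > 1` absorbs the error of the linear approximation of `f`.
  obtain ⟨C, hC1, hC⟩ : ∃ C : ℝ, 1 < C ∧ C * ‖w‖ < growthBound r := by
    have hw0 := norm_nonneg w
    have hd : 0 < growthBound r - ‖w‖ := by linarith
    refine ⟨1 + (growthBound r - ‖w‖) / (2 * (‖w‖ + 1)), ?_, ?_⟩
    · have : 0 < (growthBound r - ‖w‖) / (2 * (‖w‖ + 1)) := by positivity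
      linarith
    · have : (growthBound r - ‖w‖) / (2 * (‖w‖ + 1)) * ‖w‖ < growthBound r - ‖w‖ := by
        rw [div_mul_eq_mul_div, div_lt_iff₀ (by positivity)]
        nlinarith
      linarith
  have hsub : Metric.closedBall (0 : ℂ) r ⊆ 𝔻 := Metric.closedBall_subset_ball hr1
  -- Continuous induction along the segment from 0 to `w` replaces lifting it to a path: preimages
  -- for different `t` need not be chosen continuously.
  let S : Set ℝ := {t | ∃ z ∈ Metric.closedBall (0 : ℂ) r,
    f z = t * w ∧ growthBound ‖z‖ ≤ C * t * ‖w‖}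
  have hclosed : IsClosed (S ∩ Set.Icc 0 1) := by
    let D : Set (ℝ × ℂ) := Set.Icc 0 1 ×ˢ Metric.closedBall (0 : ℂ) r
    let G : ℝ × ℂ → ℂ × ℝ := fun q => (f q.2 - q.1 * w, C * q.1 * ‖w‖ - growthBound ‖q.2‖)
    have hD : IsCompact D := isCompact_Icc.prod (isCompact_closedBall 0 r)
    have hG : ContinuousOn G D := by
      have h1 : ContinuousOn (fun q : ℝ × ℂ => f q.2) D :=
        H.continuousOn.comp continuousOn_snd fun q hq => hsub hq.2
      have h2 : ContinuousOn (fun q : ℝ × ℂ => growthBound ‖q.2‖) D :=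
        continuousOn_growthBound.comp (by fun_prop) fun q _ => norm_nonneg q.2
      exact (h1.sub (by fun_prop)).prodMk (ContinuousOn.sub (by fun_prop) h2)
    have hK := hD.of_isClosed_subset (hG.preimage_isClosed_of_isClosed hD.isClosed
      ((isClosed_singleton (x := (0 : ℂ))).prod (isClosed_Ici (a := (0 : ℝ)))))
      Set.inter_subset_left
    have : S ∩ Set.Icc 0 1 = Prod.fst '' (D ∩ G ⁻¹' ({0} ×ˢ Set.Ici 0)) := by
      ext t
      constructor
      · rintro ⟨⟨z, hz, e1, e2⟩, ht⟩
        exact ⟨(t, z), ⟨⟨ht, hz⟩, by simp [G, e1], by simpa [G] using e2⟩, rfl⟩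
      · rintro ⟨⟨t, z⟩, ⟨⟨ht, hz⟩, e1, e2⟩, rfl⟩
        exact ⟨⟨z, hz, sub_eq_zero.1 (by simpa [G] using e1), by simpa [G] using e2⟩, ht⟩
    rw [this]
    exact (hK.image continuous_fst).isClosed
  have hS := hclosed.Icc_subset_of_forall_exists_gt
    ⟨0, by simp [hr], by simp [h0], by simp⟩ (fun t ht y hy => by
      obtain ⟨⟨z, hz, e1, e2⟩, ht0, ht1⟩ := ht
      -- On the boundary circle the growth estimate would contradict `C * ‖w‖ < growthBound r`, so
      -- the preimage is interior and can be moved.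
      have hzr : ‖z‖ < r := by
        refine lt_of_le_of_ne (by simpa using hz) fun h => ?_
        rw [h] at e2
        have : C * t * ‖w‖ ≤ C * 1 * ‖w‖ := by gcongr
        linarith
      have hz1 : ‖z‖ < 1 := hzr.trans hr1
      have hzD : z ∈ 𝔻 := hsub hz
      obtain ⟨A, hA, hAl⟩ := H.exists_hasStrictFDerivAt hzD
      set l := (1 - ‖z‖) ^ 2 / (1 + ‖z‖) ^ 4
      have hlpos : 0 < l := by
        have : 0 < 1 - ‖z‖ := by linarith
        positivity
      have hAl' : ∀ v, l * ‖v‖ ≤ ‖A v‖ := fun v =>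
        (mul_le_mul_of_nonneg_right (hl z hzD) (norm_nonneg v)).trans (hAl v)
      have hAinj : Function.Injective (A : ℂ →ₗ[ℝ] ℂ) := by
        rw [← LinearMap.ker_eq_bot, LinearMap.ker_eq_bot']
        intro v hv
        have h1 := hAl' v
        have h2 : A v = 0 := hv
        rw [h2, norm_zero] at h1
        exact norm_le_zero_iff.1 (by nlinarith [norm_nonneg v])
      -- The derivative is injective on a plane, hence surjective, so `f` is open at `z` and nearby
      -- points of the segment have nearby preimages.
      have hmap := hA.map_nhds_eq_of_surj
        (LinearMap.range_eq_top.2 (LinearMap.injective_iff_surjective.1 hAinj))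
      have hδ : 0 < l * (1 - 1 / C) := by
        have : 1 / C < 1 := by rw [div_lt_one (by linarith)]; exact hC1
        apply mul_pos hlpos; linarith
      have hN : ∀ᶠ z' in nhds z, ‖z'‖ < r ∧ l / C * ‖z' - z‖ ≤ ‖f z' - f z‖ := by
        have h1 : ∀ᶠ z' in nhds z, ‖z'‖ < r := continuous_norm.continuousAt.eventually_lt
          continuousAt_const hzr
        filter_upwards [h1, hA.hasFDerivAt.isLittleO.def hδ] with z' h1 h2
        refine ⟨h1, ?_⟩
        have h3 := hAl' (z' - z)
        have h4 := norm_sub_norm_le (A (z' - z)) (f z' - f z)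
        rw [norm_sub_rev (A (z' - z))] at h4
        have h5 : l * (1 - 1 / C) * ‖z' - z‖ = l * ‖z' - z‖ - l / C * ‖z' - z‖ := by ring
        linarith
      have himg : f '' {z' | ‖z'‖ < r ∧ l / C * ‖z' - z‖ ≤ ‖f z' - f z‖} ∈ nhds (t * w) := by
        rw [← e1, ← hmap]
        exact Filter.image_mem_map hN
      have hcont : Filter.Tendsto (fun t' : ℝ => (t' : ℂ) * w) (nhdsWithin t (Set.Ioi t))
          (nhds (t * w)) :=
        ((Complex.continuous_ofReal.mul continuous_const).tendsto t).mono_left nhdsWithin_le_nhds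
      obtain ⟨t', ⟨z', ⟨hz'r, hz'⟩, e3⟩, ht'⟩ :=
        Filter.nonempty_of_mem (Filter.inter_mem (Filter.mem_map.1 (hcont himg))
          (Ioc_mem_nhdsGT (Set.mem_Ioi.1 hy)))
      refine ⟨t', ⟨z', by simpa using hz'r.le, e3, ?_⟩, ht'⟩
      have h6 : ‖f z' - f z‖ = (t' - t) * ‖w‖ := by
        rw [e3, e1, ← sub_mul, norm_mul, ← Complex.ofReal_sub, Complex.norm_real,
          Real.norm_of_nonneg (by linarith [ht'.1])]
      rw [h6, div_mul_eq_mul_div, div_le_iff₀ (by linarith)] at hz'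
      have h7 := growthBound_le_tangent (norm_nonneg z) hz1 (norm_nonneg z') (hz'r.trans hr1)
      have h8 : l * (‖z'‖ - ‖z‖) ≤ l * ‖z' - z‖ := by
        gcongr; exact norm_sub_norm_le z' z
      linarith)
  -- At `t = 1` injectivity identifies the preimage with `z₀`, contradicting the choice of `C`.
  obtain ⟨z, hz, e1, e2⟩ := hS (Set.right_mem_Icc.2 zero_le_one)
  rw [Complex.ofReal_one, one_mul] at e1
  rw [hinj (hsub hz) hz₀ e1, mul_one] at e2
  linarith

theorem diskShift_neg_diskShift {a b : ℂ} (ha : a ∈ 𝔻) (hb : b ∈ 𝔻) :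
    diskShift a (diskShift (-a) b) = b := by
  have ha' : -a ∈ 𝔻 := mem_disk_of_norm_lt (by rw [norm_neg]; exact norm_lt_one_of_mem ha)
  have h1 := one_add_conj_mul_ne_zero ha' hb
  have h3 := one_add_conj_mul_ne_zero ha (diskShift_mem ha' hb)
  rw [map_neg, neg_mul, ← sub_eq_add_neg] at h1
  rw [diskShift, div_eq_iff h3, diskShift, map_neg, neg_mul, ← sub_eq_add_neg, ← sub_eq_add_neg]
  have hq := div_mul_cancel₀ (b - a) h1
  refine mul_right_cancel₀ h1 ?_
  linear_combination (1 - b * (starRingEnd ℂ) a) * hq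

theorem diskShift_injOn {a : ℂ} (ha : a ∈ 𝔻) : Set.InjOn (diskShift a) 𝔻 := by
  have ha' : -a ∈ 𝔻 := mem_disk_of_norm_lt (by rw [norm_neg]; exact norm_lt_one_of_mem ha)
  intro z hz w hw h
  have h1 := diskShift_neg_diskShift ha' hz
  have h2 := diskShift_neg_diskShift ha' hw
  rw [neg_neg] at h1 h2
  rw [← h1, ← h2, h]

theorem injective_add_mul_conj {ε : ℂ} (hε : ‖ε‖ < 1) :
    Function.Injective fun w : ℂ => w + ε * (starRingEnd ℂ) w := by
  intro v w h
  have h1 : v - w = -(ε * (starRingEnd ℂ) (v - w)) := by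
    rw [map_sub]
    linear_combination h
  have h2 := congrArg norm h1
  rw [norm_neg, norm_mul, RCLike.norm_conj] at h2
  have h3 : ‖v - w‖ = 0 := by
    have := norm_nonneg (v - w)
    nlinarith
  exact sub_eq_zero.1 (norm_eq_zero.1 h3)

/-- The growth theorem for the univalent members of the family, without normalization
of `f_{z̄}(0)`. -/
theorem growthBound_mul_le_norm {f h g : ℂ → ℂ} (hf : f ∈ UH (5 / 2)) (H : IsCanonicalRep f h g)
    (hinj : Set.InjOn f 𝔻) {z : ℂ} (hz : z ∈ 𝔻) :
    (1 - ‖deriv g 0‖) * growthBound ‖z‖ ≤ ‖f z‖ := by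
  obtain ⟨f0, h0, h1, hlt⟩ := (isNormalizedSensePreserving_of_mem_UH hf).of_rep H
  have hB := hlt 0 zero_mem_disk
  rw [h1, norm_one] at hB
  set B := deriv g 0 with hBdef
  -- This choice makes the coanalytic derivative of the affine change vanish at 0.
  set ε := -(starRingEnd ℂ) B with hεdef
  have hε : ‖ε‖ = ‖B‖ := by rw [hεdef, norm_neg, RCLike.norm_conj]
  have hεB : 1 + ε * B = ((1 - ‖B‖ ^ 2 : ℝ) : ℂ) := by
    rw [← one_sub_conj_mul_self, hεdef]; ring
  have hpos : 0 < 1 - ‖B‖ ^ 2 := by nlinarith [norm_nonneg B]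
  have hF := affineChange_mem_UH hf H (mem_disk_of_norm_lt (hε.trans_lt hB))
  have HF := H.affineChange h0 ε
  have hg' : deriv (fun z => (g z + (starRingEnd ℂ) ε * h z)
      / (starRingEnd ℂ) (1 + ε * deriv g 0)) 0 = 0 := by
    have d1 := (H.analytic_g 0 zero_mem_disk).differentiableAt.hasDerivAt
    have d2 := (H.analytic_h 0 zero_mem_disk).differentiableAt.hasDerivAt
    refine ((d1.add (d2.const_mul ((starRingEnd ℂ) ε))).div_const _).deriv.trans ?_
    rw [h1, hεdef]
    simp [← hBdef]
  have hinjF : Set.InjOn (affineChange f g ε) 𝔻 := by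
    intro v hv w hw h
    simp only [affineChange] at h
    rw [← hBdef, hεB, div_left_inj' (by exact_mod_cast hpos.ne')] at h
    exact hinj hv hw (injective_add_mul_conj (hε.trans_lt hB) h)
  have hgrow := growthBound_le_norm HF hinjF (by simp [affineChange, f0])
    (fun z hz => le_norm_deriv_sub_norm_deriv hF HF hg' hz) hz
  rw [affineChange, ← hBdef, hεB, norm_div, Complex.norm_real, Real.norm_of_nonneg hpos.le,
    le_div_iff₀ hpos] at hgrow
  have h2 : ‖f z + ε * (starRingEnd ℂ) (f z)‖ ≤ (1 + ‖B‖) * ‖f z‖ := by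
    refine (norm_add_le _ _).trans_eq ?_
    rw [norm_mul, RCLike.norm_conj, hε]
    ring
  have h3 : (1 + ‖B‖) * ((1 - ‖B‖) * growthBound ‖z‖) ≤ (1 + ‖B‖) * ‖f z‖ := by
    refine le_trans (le_of_eq ?_) (hgrow.trans h2)
    ring
  exact le_of_mul_le_mul_left h3 (by positivity)

/-! ### Two-point distortion. -/

/-- The pseudohyperbolic distance in `|z| ≤ r` is largest for antipodal points `±r`, where it is
`2r/(1 + r²)`. -/
theorem pseudoHyperbolic_bounds {a b : ℂ} {r : ℝ} (hr : r < 1) (ha : ‖a‖ ≤ r) (hb : ‖b‖ ≤ r) :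
    ‖diskShift (-a) b‖ ≤ 2 * r / (1 + r ^ 2) ∧
      ‖b - a‖ / (1 + r ^ 2) ≤ ‖diskShift (-a) b‖ := by
  have ha' : -a ∈ 𝔻 := mem_disk_of_norm_lt (by rw [norm_neg]; exact ha.trans_lt hr)
  have hbD : b ∈ 𝔻 := mem_disk_of_norm_lt (hb.trans_lt hr)
  have hr0 : 0 ≤ r := (norm_nonneg a).trans ha
  have hid := normSq_sub_normSq_diskShift (-a) b
  have hne := norm_pos_iff.2 (one_add_conj_mul_ne_zero ha' hbD)
  have hle : ‖1 + (starRingEnd ℂ) (-a) * b‖ ≤ 1 + r ^ 2 := by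
    refine (norm_add_le _ _).trans ?_
    rw [norm_mul, RCLike.norm_conj, norm_neg, norm_one, sq]
    gcongr
  rw [diskShift, norm_div, ← sub_eq_add_neg]
  rw [norm_neg, ← sub_eq_add_neg] at hid
  set m := ‖1 + (starRingEnd ℂ) (-a) * b‖
  set d := ‖b - a‖
  have hd0 : 0 ≤ d := norm_nonneg _
  constructor
  · rw [div_le_div_iff₀ hne (by positivity)]
    refine le_of_sq_le_sq ?_ (by positivity)
    have h1 : (1 - r ^ 2) ^ 2 ≤ (1 - ‖a‖ ^ 2) * (1 - ‖b‖ ^ 2) := by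
      rw [sq (1 - r ^ 2)]
      have h2 : ‖a‖ ^ 2 ≤ r ^ 2 := by gcongr
      have h3 : ‖b‖ ^ 2 ≤ r ^ 2 := by gcongr
      have h4 : 0 ≤ 1 - r ^ 2 := by nlinarith
      apply mul_le_mul <;> linarith
    have h5 : m ^ 2 ≤ (1 + r ^ 2) ^ 2 := by gcongr
    have h6 : d ^ 2 ≤ m ^ 2 - (1 - r ^ 2) ^ 2 := by linarith
    have h7 : d ^ 2 * (1 + r ^ 2) ^ 2 ≤ (m ^ 2 - (1 - r ^ 2) ^ 2) * (1 + r ^ 2) ^ 2 := by gcongr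
    have h8 : (1 - r ^ 2) ^ 2 * m ^ 2 ≤ (1 - r ^ 2) ^ 2 * (1 + r ^ 2) ^ 2 := by gcongr
    nlinarith
  · gcongr

/-- The two-point distortion theorem for the univalent members of the family. -/
theorem quotientBound_mul_norm_sub_le {f h g : ℂ → ℂ} (hf : f ∈ UH (5 / 2))
    (H : IsCanonicalRep f h g) (hg : deriv g 0 = 0) (hinj : Set.InjOn f 𝔻) {a b : ℂ} {r : ℝ}
    (hr0 : 0 < r) (hr : r < 1) (ha : ‖a‖ ≤ r) (hb : ‖b‖ ≤ r) :
    quotientBound ((1 - r) / (1 + r)) * ‖b - a‖ ≤ ‖f b - f a‖ := by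
  rcases eq_or_ne b a with rfl | hab
  · simp
  have haD : a ∈ 𝔻 := mem_disk_of_norm_lt (ha.trans_lt hr)
  have ha' : -a ∈ 𝔻 := mem_disk_of_norm_lt (by rw [norm_neg]; exact ha.trans_lt hr)
  have hbD : b ∈ 𝔻 := mem_disk_of_norm_lt (hb.trans_lt hr)
  have hlt := ((isNormalizedSensePreserving_of_mem_UH hf).of_rep H).2.2.2 a haD
  have hstretch := le_norm_deriv_sub_norm_deriv hf H hg haD
  have hp : 0 < ‖deriv h a‖ := (norm_nonneg _).trans_lt hlt
  have hρ0 := norm_nonneg a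
  have hρ1 : 0 < 1 - ‖a‖ := by linarith
  have hs : 0 < 1 - ‖a‖ ^ 2 := by nlinarith
  set ζ := diskShift (-a) b with hζ
  have hζD : ζ ∈ 𝔻 := diskShift_mem ha' hbD
  have hζb : diskShift a ζ = b := diskShift_neg_diskShift haD hbD
  have hKval : ∀ z, koebeTransform f h 0 a z
      = (f (diskShift a z) - f a) / ((1 - ‖a‖ ^ 2 : ℝ) * deriv h a) := by
    intro z
    simp [koebeTransform, diskShift]
  have hc : ((1 - ‖a‖ ^ 2 : ℝ) : ℂ) * deriv h a ≠ 0 :=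
    mul_ne_zero (by exact_mod_cast hs.ne') (norm_pos_iff.1 hp)
  have hinjK : Set.InjOn (koebeTransform f h 0 a) 𝔻 := by
    intro v hv w hw hvw
    rw [hKval, hKval, div_left_inj' hc] at hvw
    exact diskShift_injOn haD hv hw
      (hinj (diskShift_mem haD hv) (diskShift_mem haD hw) (sub_left_inj.1 hvw))
  have hgrow := growthBound_mul_le_norm (koebeTransform_mem_UH hf H 0 haD) (H.koebeTransform haD)
    hinjK hζD
  have hnB : ‖deriv g a * ((1 - ‖a‖ ^ 2 : ℝ) : ℂ)
      / (starRingEnd ℂ) ((1 - ‖a‖ ^ 2 : ℝ) * deriv h a)‖ = ‖deriv g a‖ / ‖deriv h a‖ := by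
    rw [norm_div, RCLike.norm_conj, norm_mul, norm_mul, Complex.norm_real,
      Real.norm_of_nonneg hs.le]
    field_simp
  rw [deriv_shiftQuotient_zero H.analytic_g haD, hnB, hKval, hζb, norm_div, norm_mul,
    Complex.norm_real, Real.norm_of_nonneg hs.le, le_div_iff₀ (by positivity)] at hgrow
  have hgrow' : (1 - ‖a‖ ^ 2) * (‖deriv h a‖ - ‖deriv g a‖) * growthBound ‖ζ‖
      ≤ ‖f b - f a‖ := by
    refine le_trans (le_of_eq ?_) hgrow
    field_simp
  obtain ⟨hup, hlow⟩ := pseudoHyperbolic_bounds hr ha hb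
  rw [← hζ] at hup hlow
  have hd : 0 < ‖b - a‖ := norm_pos_iff.2 (sub_ne_zero.2 hab)
  have hζ0 : 0 < ‖ζ‖ := (by positivity : 0 < ‖b - a‖ / (1 + r ^ 2)).trans_le hlow
  have hσ1 : 2 * r / (1 + r ^ 2) < 1 := by
    rw [div_lt_one (by positivity)]
    nlinarith [mul_pos (sub_pos.2 hr) (sub_pos.2 hr)]
  -- By concavity the slope from the origin at `‖ζ‖` is at least that at the maximal distance `2r/(1
  -- + r²)`.
  have hconc := growthBound_mul_le hζ0 hup hσ1
  set x := (1 - r) / (1 + r) with hx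
  have hx0 : 0 < x := div_pos (by linarith) (by linarith)
  have hx1 : x ≤ 1 := by rw [hx, div_le_one (by linarith)]; linarith
  -- In hyperbolic terms `2r/(1 + r²)` is twice as far from 0 as `r`, so `x` becomes `x²`.
  have hσ : growthBound (2 * r / (1 + r ^ 2)) = (1 - x ^ 6) / 6 := by
    have : (1 - 2 * r / (1 + r ^ 2)) / (1 + 2 * r / (1 + r ^ 2)) = x ^ 2 := by
      have e1 : 1 - 2 * r / (1 + r ^ 2) = (1 - r) ^ 2 / (1 + r ^ 2) := by field_simp; ring
      have e2 : 1 + 2 * r / (1 + r ^ 2) = (1 + r) ^ 2 / (1 + r ^ 2) := by field_simp; ring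
      rw [e1, e2, hx]
      field_simp
    rw [growthBound, this]
    ring
  have hx6 : 0 ≤ (1 - x ^ 6) / 6 := by
    have := pow_le_one₀ hx0.le hx1 (n := 6)
    linarith
  have hgb : (1 - x ^ 6) / 6 * ‖b - a‖ / (2 * r) ≤ growthBound ‖ζ‖ := by
    rw [hσ, mul_div_assoc', le_div_iff₀ (by positivity)] at hconc
    rw [div_le_iff₀ (by positivity)]
    rw [div_le_iff₀ (by positivity)] at hlow
    calc (1 - x ^ 6) / 6 * ‖b - a‖ ≤ (1 - x ^ 6) / 6 * (‖ζ‖ * (1 + r ^ 2)) := by gcongr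
      _ ≤ growthBound ‖ζ‖ * (2 * r) := by linarith
  have hx3 : x ^ 3 ≤ (1 - ‖a‖ ^ 2) * (‖deriv h a‖ - ‖deriv g a‖) := by
    have h1 : x ≤ (1 - ‖a‖) / (1 + ‖a‖) := by
      rw [hx, div_le_div_iff₀ (by linarith) (by linarith)]
      nlinarith
    calc x ^ 3 ≤ ((1 - ‖a‖) / (1 + ‖a‖)) ^ 3 := by gcongr
      _ = (1 - ‖a‖ ^ 2) * ((1 - ‖a‖) ^ 2 / (1 + ‖a‖) ^ 4) := by field_simp; ring
      _ ≤ _ := by gcongr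
  rw [← quotientBound_eq hr0, ← hx]
  calc 1 / (12 * r) * x ^ 3 * (1 - x ^ 6) * ‖b - a‖
      = x ^ 3 * ((1 - x ^ 6) / 6 * ‖b - a‖ / (2 * r)) := by field_simp; ring
    _ ≤ (1 - ‖a‖ ^ 2) * (‖deriv h a‖ - ‖deriv g a‖) * growthBound ‖ζ‖ := by
        gcongr
    _ ≤ _ := hgrow'

/-! ### Remainders and univalence of the sections. -/

theorem norm_pow_succ_sub_pow_succ_le {z w : ℂ} {r : ℝ} (hz : ‖z‖ ≤ r) (hw : ‖w‖ ≤ r) (k : ℕ) :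
    ‖z ^ (k + 1) - w ^ (k + 1)‖ ≤ (k + 1) * r ^ k * ‖z - w‖ := by
  have hr : 0 ≤ r := (norm_nonneg z).trans hz
  induction k with
  | zero => simp
  | succ k ih =>
    have : z ^ (k + 1 + 1) - w ^ (k + 1 + 1)
        = z * (z ^ (k + 1) - w ^ (k + 1)) + w ^ (k + 1) * (z - w) := by ring
    rw [this]
    calc ‖z * (z ^ (k + 1) - w ^ (k + 1)) + w ^ (k + 1) * (z - w)‖
        ≤ ‖z‖ * ‖z ^ (k + 1) - w ^ (k + 1)‖ + ‖w‖ ^ (k + 1) * ‖z - w‖ := by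
          refine (norm_add_le _ _).trans_eq ?_
          rw [norm_mul, norm_mul, norm_pow]
      _ ≤ r * ((k + 1) * r ^ k * ‖z - w‖) + r ^ (k + 1) * ‖z - w‖ := by gcongr
      _ = _ := by push_cast; ring

theorem hasSum_taylorCoeff {u : ℂ → ℂ} (hu : AnalyticOnNhd ℂ u 𝔻) {z : ℂ} (hz : z ∈ 𝔻) :
    HasSum (fun k => taylorCoeff u k * z ^ k) (u z) := by
  have hs := Complex.hasSum_taylorSeries_on_ball hu.differentiableOn hz
  have he : (fun k : ℕ => ((k.factorial : ℂ))⁻¹ • (z - 0) ^ k • iteratedDeriv k u 0)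
      = fun k => taylorCoeff u k * z ^ k := by
    funext k
    simp only [taylorCoeff, smul_eq_mul, sub_zero]
    ring
  rwa [he] at hs

theorem norm_sub_analyticSection_le {u : ℂ → ℂ} (hu : AnalyticOnNhd ℂ u 𝔻) {n : ℕ} {c : ℝ}
    (hc : ∀ k, n + 1 ≤ k → (k : ℝ) * ‖taylorCoeff u k‖ ≤ c * (k : ℝ) ^ 4) {z w : ℂ} {r : ℝ}
    (hr : r < 1) (hz : ‖z‖ ≤ r) (hw : ‖w‖ ≤ r) :
    ‖(u z - u w) - (analyticSection n u z - analyticSection n u w)‖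
      ≤ c * quarticTail n r * ‖z - w‖ := by
  have hr0 : 0 ≤ r := (norm_nonneg z).trans hz
  have hs := (hasSum_nat_add_iff' (n + 1)).2
    ((hasSum_taylorCoeff hu (mem_disk_of_norm_lt (hz.trans_lt hr))).sub
    (hasSum_taylorCoeff hu (mem_disk_of_norm_lt (hw.trans_lt hr))))
  have hsec : ∑ k ∈ Finset.range (n + 1), (taylorCoeff u k * z ^ k - taylorCoeff u k * w ^ k)
      = analyticSection n u z - analyticSection n u w := by
    rw [Finset.sum_range_succ', analyticSection, analyticSection, ← Finset.sum_sub_distrib,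
      Finset.range_eq_Ico, Finset.sum_Ico_add' (fun k => taylorCoeff u k * z ^ k
        - taylorCoeff u k * w ^ k) 0 n 1]
    -- The constant term, absent from the section, cancels in the difference.
    simp only [pow_zero, sub_self, add_zero]
    rfl
  rw [hsec] at hs
  have hb := ((summable_quarticTail n hr0 hr).hasSum.mul_left c).mul_right ‖z - w‖
  refine hs.tsum_eq ▸ tsum_of_norm_bounded hb fun j => ?_
  rw [← mul_sub, norm_mul]
  have h1 := norm_pow_succ_sub_pow_succ_le hz hw (n + j)
  have h2 := hc (n + 1 + j) (by omega)
  rw [show j + (n + 1) = n + j + 1 by ring]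
  rw [show n + 1 + j = n + j + 1 by ring] at h2 ⊢
  calc ‖taylorCoeff u (n + j + 1)‖ * ‖z ^ (n + j + 1) - w ^ (n + j + 1)‖
      ≤ ‖taylorCoeff u (n + j + 1)‖ * (((n + j : ℕ) + 1) * r ^ (n + j) * ‖z - w‖) := by gcongr
    _ = (((n + j + 1 : ℕ) : ℝ) * ‖taylorCoeff u (n + j + 1)‖) * (r ^ (n + j) * ‖z - w‖) := by
        push_cast; ring
    _ ≤ (c * ((n + j + 1 : ℕ) : ℝ) ^ 4) * (r ^ (n + j) * ‖z - w‖) := by gcongr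
    _ = _ := by ring

theorem injOn_harmonicSection {f h g : ℂ → ℂ} (hf : f ∈ UH (5 / 2)) (H : IsCanonicalRep f h g)
    (hg : deriv g 0 = 0) (hinj : Set.InjOn f 𝔻) {n m : ℕ} (hn : 1 ≤ n) (hm : 2 ≤ m) {ρ : ℝ}
    (hρ : ρ ≤ 1) (hpos : ∀ r ∈ Set.Ioo 0 ρ, 0 < phiExt n m r) :
    Set.InjOn (harmonicSection n m h g) (Metric.ball 0 ρ) := by
  intro z hz w hw hzw
  by_contra hne
  rw [mem_ball_zero_iff] at hz hw
  set r := max ‖z‖ ‖w‖ with hr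
  have hzr : ‖z‖ ≤ r := le_max_left _ _
  have hwr : ‖w‖ ≤ r := le_max_right _ _
  have hd : 0 < ‖z - w‖ := norm_pos_iff.2 (sub_ne_zero.2 hne)
  have hr0 : 0 < r := by linarith [norm_sub_le z w]
  have hrρ : r < ρ := max_lt hz hw
  have hr1 : r < 1 := hrρ.trans_le hρ
  have h1 := quotientBound_mul_norm_sub_le hf H hg hinj hr0 hr1 hwr hzr
  have h2 := norm_sub_analyticSection_le H.analytic_h (n := n) (c := 3 / 4)
    (fun k hk => norm_taylorCoeff_analytic_le hf H hg (by omega)) hr1 hzr hwr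
  have h3 := norm_sub_analyticSection_le H.analytic_g (n := m) (c := 43 / 100)
    (fun k hk => norm_taylorCoeff_coanalytic_le hf H hg (by omega)) hr1 hzr hwr
  have hzw' := hzw
  simp only [harmonicSection] at hzw'
  -- If the section takes equal values at `z` and `w`, then `f z - f w` consists of the two
  -- remainders alone.
  have he : f z - f w = ((h z - h w) - (analyticSection n h z - analyticSection n h w))
      + (starRingEnd ℂ) ((g z - g w) - (analyticSection m g z - analyticSection m g w)) := by
    rw [H.eq_add z (mem_disk_of_norm_lt (hzr.trans_lt hr1)),
      H.eq_add w (mem_disk_of_norm_lt (hwr.trans_lt hr1))]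
    simp only [map_sub]
    linear_combination hzw'
  have h4 := norm_add_le ((h z - h w) - (analyticSection n h z - analyticSection n h w))
    ((starRingEnd ℂ) ((g z - g w) - (analyticSection m g z - analyticSection m g w)))
  rw [← he, RCLike.norm_conj] at h4
  have h5 := mul_pos (hpos r ⟨hr0, hrρ⟩) hd
  rw [phiExt] at h5
  nlinarith

end HarmonicSections

theorem theorem4 :
    ∃ rad : ℕ → ℕ → ℝ,
      -- `rad n m` is the unique positive root (in the interval `(0, 1)` of convergence)
      (∀ n m : ℕ, 1 ≤ n → 2 ≤ m →
        (rad n m ∈ Set.Ioo (0 : ℝ) 1 ∧ HarmonicSections.phi n m (rad n m) = 0) ∧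
        ∀ r ∈ Set.Ioo (0 : ℝ) 1, HarmonicSections.phi n m r = 0 → r = rad n m) ∧
      -- the sections are univalent in `|z| < rad n m`
      (∀ f ∈ HarmonicSections.UH0 (5 / 2) ∩ HarmonicSections.SH0,
        ∀ h g : ℂ → ℂ, HarmonicSections.IsCanonicalRep f h g →
        ∀ n m : ℕ, 1 ≤ n → 2 ≤ m →
          Set.InjOn (HarmonicSections.harmonicSection n m h g)
            (Metric.ball (0 : ℂ) (rad n m))) ∧
      -- lower bounds for the radii
      (∀ n : ℕ, 20 ≤ n → HarmonicSections.rL n < rad n n) ∧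
      (∀ n m : ℕ, 20 ≤ min n m → HarmonicSections.rL (min n m) ≤ rad n m) := by
  have hex : ∀ n m : ℕ, ∃ ρ : ℝ, 1 ≤ n → 1 ≤ m →
      ρ ∈ Set.Ioo (0 : ℝ) 1 ∧ HarmonicSections.phiExt n m ρ = 0 := by
    intro n m
    by_cases hnm : 1 ≤ n ∧ 1 ≤ m
    · obtain ⟨ρ, h1, h2⟩ := HarmonicSections.exists_root hnm.1 hnm.2
      exact ⟨ρ, fun _ _ => ⟨h1, h2⟩⟩
    -- The value 0 outside the admissible indices is arbitrary.
    · exact ⟨0, fun h1 h2 => absurd ⟨h1, h2⟩ hnm⟩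
  choose rad hrad using hex
  refine ⟨rad, fun n m hn hm => ?_, fun f hf h g H n m hn hm => ?_, fun n hn => ?_,
    fun n m hnm => ?_⟩
  · obtain ⟨hmem, h0⟩ := hrad n m hn (by omega)
    refine ⟨⟨hmem, (HarmonicSections.phi_eq hmem.1).trans h0⟩, fun r hr hr0 => ?_⟩
    refine (HarmonicSections.phiExt_strictAntiOn hn (show 1 ≤ m by omega)).injOn
      (Set.Ioo_subset_Ico_self hr) (Set.Ioo_subset_Ico_self hmem) ?_
    rw [h0]
    exact (HarmonicSections.phi_eq hr.1).symm.trans hr0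
  · obtain ⟨hmem, h0⟩ := hrad n m hn (by omega)
    obtain ⟨⟨hU, h₁, g₁, H₁, hg₁⟩, -, hinj, -⟩ := hf
    have hg : deriv g 0 = 0 :=
      (HarmonicSections.deriv_eqOn_disk (H.unique H₁).2 HarmonicSections.zero_mem_disk).trans hg₁
    refine HarmonicSections.injOn_harmonicSection hU H hg hinj hn hm hmem.2.le fun r hr => ?_
    rw [← h0]
    exact HarmonicSections.phiExt_strictAntiOn hn (show 1 ≤ m by omega)
      ⟨hr.1.le, hr.2.trans hmem.2⟩ (Set.Ioo_subset_Ico_self hmem) hr.2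
  · obtain ⟨hmem, h0⟩ := hrad n n (by omega) (by omega)
    exact HarmonicSections.rL_lt_of_phiExt_eq_zero hn le_rfl le_rfl hmem h0
  · obtain ⟨hmem, h0⟩ := hrad n m (by omega) (by omega)
    exact (HarmonicSections.rL_lt_of_phiExt_eq_zero hnm (min_le_left n m) (min_le_right n m)
      hmem h0).le
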